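/- Let $U\subset\mathbb{R}^4$ be a connected open set with coordinates $(\zeta,u,v)$, $\zeta=x+\mathrm{i}y$, and let $f=f(\zeta,u)$ be a complex function, defined and smooth on the projection of $U$ to the $(\zeta,u)$-space and holomorphic in $\zeta$. It defines the vacuum pp-wave metric $$ds^2=2\,d\zeta\,d\bar\zeta-2\,du\,dv-(f+\bar f)\,du^2 .$$ Let $(\delta,\delta^*,\Delta,D)$ be a smooth null tetrad on $U$ ($\delta^*$ the conjugate of $\delta$; $\Delta,D$ real; $g(\delta,\delta^*)=1$, $g(\Delta,D)=-1$, all other products $0$), with $D$ proportional to the parallel null field $\partial_v$, normalized by $\Psi_4=1$, $\gamma=0$, where $$\Psi_4=C(\Delta,\delta^*,\Delta,\delta^*),\quad \gamma=\tfrac12\big(g(D,\nabla_\Delta\Delta)-g(\delta,\nabla_\Delta\delta^*)\big),$$ $$\alpha=\tfrac12\big(g(D,\nabla_{\delta^*}\Delta)-g(\delta,\nabla_{\delta^*}\delta^*)\big),\quad \mu=g(\delta^*,\nabla_\delta\Delta).$$ Assume that $\alpha\neq0$ on $U$, and put $A=\delta^*\alpha/\alpha^2$ and $B=\mu A-\mu^*$,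 where $*$ is complex conjugation. Suppose that the metric is of type $(0,1)$, i.e. $d\alpha\wedge d\alpha^*=0$ on $U$. Then $B=0$ on $U$, and one of the following holds on $U$: * ($\mathrm{P}_{13}$) $AA^*=1$ and $A^2\ne1$ everywhere, and $\hat f=(k_0e^{\mathrm{i}h}\hat\zeta)^{2\mathrm{i}k_1}+g\hat\zeta$ with real constants $k_0>0$, $k_1\neq0$; * ($\mathrm{E}_{13}$) $A=-1$ everywhere, and $\hat f=\exp(k\,e^{\mathrm{i}h}\hat\zeta)+g\hat\zeta$ with a real constant $k>0$; * ($\mathrm{L}_{13}$) $A=1$ everywhere, and $\hat f=e^{\mathrm{i}k}h\log\hat\zeta+g\hat\zeta$ with a real constant $k$ and $h\neq0$ everywhere. Here $h=h(u)$ is a smooth real function and $g=g(u)$ a smooth complex function. The class and its constants $k_0,k_1,k$ are the same on all of $U$. The formula for $\hat f$ is meant locally and up to a form-preserving change of coordinates: every point $(\zeta_0,u_0)$ of the projection of $U$ has a neighbourhood in it, a product of a disc and an interval, over which there are smooth functions $s(u)\in\mathbb{C}$ and $w(u)\in\mathbb{R}$ such that $$\hat\zeta=\zeta+s(u),\qquad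 \hat u=u,\qquad \hat v=v+s'(u)\bar\zeta+\bar s'(u)\zeta+w(u)$$ carries the metric of $f$ to the metric of the same form with a function $\hat f(\hat\zeta,\hat u)$ of the stated form, for some $h,g$ and a continuous branch of the logarithm (by which the power is also defined). -/

import Mathlib

open scoped ContDiff ComplexConjugate

noncomputable section

namespace PPWave

/-! ### Tensor calculus on open subsets of `ℝ⁴` -/

/-- Points of the coordinate space, with real coordinates `(x, y, u, v)`, where `ζ = x + i y`. -/
abbrev Pt : Type := Fin 4 → ℝ

/-- Complexified vector fields, given by their components in the coordinate frame. -/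
abbrev VF : Type := Pt → Fin 4 → ℂ

/-- The coordinate derivative `∂_i F` at `p`. -/
def pd {E : Type*} [NormedAddCommGroup E] [NormedSpace ℝ E] (i : Fin 4) (F : Pt → E) (p : Pt) : E :=
  fderiv ℝ F p (Pi.single i 1)

/-- The Christoffel symbols `Γ^k_{ij}` of the metric with coefficient matrix `G`. -/
def christoffel (G : Pt → Matrix (Fin 4) (Fin 4) ℝ) (k i j : Fin 4) (p : Pt) : ℝ :=
  (1 / 2) * ∑ l, (G p)⁻¹ k l *
    (pd i (fun q => G q j l) p + pd j (fun q => G q i l) p - pd l (fun q => G q i j) p)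

/-- The curvature components `R^a_{bcd} = ∂_c Γ^a_{db} - ∂_d Γ^a_{cb} + Γ^a_{cm} Γ^m_{db} -
Γ^a_{dm} Γ^m_{cb}`. -/
def riemannUp (G : Pt → Matrix (Fin 4) (Fin 4) ℝ) (a b c d : Fin 4) (p : Pt) : ℝ :=
  pd c (christoffel G a d b) p - pd d (christoffel G a c b) p +
    ∑ m, (christoffel G a c m p * christoffel G m d b p -
      christoffel G a d m p * christoffel G m c b p)

/-- The fully covariant curvature components `R_{abcd}`. -/
def riemann (G : Pt → Matrix (Fin 4) (Fin 4) ℝ) (a b c d : Fin 4) (p : Pt) : ℝ :=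
  ∑ k, G p a k * riemannUp G k b c d p

/-- The complex bilinear extension of the metric. -/
def ip (G : Pt → Matrix (Fin 4) (Fin 4) ℝ) (X Y : VF) (p : Pt) : ℂ :=
  ∑ i, ∑ j, (G p i j : ℂ) * X p i * Y p j

/-- The covariant derivative `∇_X Y` (Levi-Civita connection, extended complex linearly). -/
def cov (G : Pt → Matrix (Fin 4) (Fin 4) ℝ) (X Y : VF) : VF := fun p k =>
  ∑ i, X p i * (pd i (fun q => Y q k) p + ∑ j, (christoffel G k i j p : ℂ) * Y p j)

/-- The curvature tensor `R(X, Y, Z, W) = R_{abcd} X^a Y^b Z^c W^d`. -/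
def curv (G : Pt → Matrix (Fin 4) (Fin 4) ℝ) (X Y Z W : VF) (p : Pt) : ℂ :=
  ∑ a, ∑ b, ∑ c, ∑ d, (riemann G a b c d p : ℂ) * X p a * Y p b * Z p c * W p d

/-- The derivative `X F` of a complex function along a complexified vector field. -/
def along (X : VF) (F : Pt → ℂ) (p : Pt) : ℂ := ∑ i, X p i * pd i F p

/-- Complex conjugate of a complexified vector field. -/
def cvf (X : VF) : VF := fun p i => conj (X p i)

/-- `dF ∧ dK = 0` on `U`. -/
def WedgeZeroOn (F K : Pt → ℂ) (U : Set Pt) : Prop :=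
  ∀ p ∈ U, ∀ i j : Fin 4, pd i F p * pd j K p - pd j F p * pd i K p = 0

/-! ### Vacuum pp-waves -/

/-- The complex coordinate `ζ`. -/
def zeta (p : Pt) : ℂ := ⟨p 0, p 1⟩

/-- The pair `(ζ, u)`. -/
def zu (p : Pt) : ℂ × ℝ := (zeta p, p 2)

/-- The metric `2 dζ dζ̄ - 2 du dv - (f + f̄) du²` in the coordinates `(x, y, u, v)`. -/
def metric (f : ℂ → ℝ → ℂ) (p : Pt) : Matrix (Fin 4) (Fin 4) ℝ :=
  !![2, 0, 0, 0;
     0, 2, 0, 0;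
     0, 0, -(2 * (f (zeta p) (p 2)).re), -1;
     0, 0, -1, 0]

/-- `f` defines a vacuum pp-wave on the region `U`: it is smooth in `(ζ, u)`
and holomorphic in `ζ`. -/
structure IsVacuumPPWave (f : ℂ → ℝ → ℂ) (U : Set Pt) : Prop where
  smooth : ContDiffOn ℝ ∞ (fun q : ℂ × ℝ => f q.1 q.2) (zu '' U)
  holo : ∀ q ∈ zu '' U, DifferentiableAt ℂ (fun z => f z q.2) q.1

/-- A tetrad `(δ, δ*, Δ, D)`; `δ*` is the complex conjugate of `δ`. -/
structure Tetrad where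
  delta : VF
  Delta : VF
  D : VF

namespace Tetrad

/-- The vector field `δ*`. -/
def deltaBar (e : Tetrad) : VF := cvf e.delta

/-- The spin coefficient `α = ½ (g(D, ∇_{δ*} Δ) - g(δ, ∇_{δ*} δ*))`. -/
def alpha (e : Tetrad) (f : ℂ → ℝ → ℂ) (p : Pt) : ℂ :=
  (1 / 2) * (ip (metric f) e.D (cov (metric f) e.deltaBar e.Delta) p -
    ip (metric f) e.delta (cov (metric f) e.deltaBar e.deltaBar) p)

/-- The spin coefficient `γ = ½ (g(D, ∇_Δ Δ) - g(δ, ∇_Δ δ*))`. -/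
def gamma (e : Tetrad) (f : ℂ → ℝ → ℂ) (p : Pt) : ℂ :=
  (1 / 2) * (ip (metric f) e.D (cov (metric f) e.Delta e.Delta) p -
    ip (metric f) e.delta (cov (metric f) e.Delta e.deltaBar) p)

/-- The spin coefficient `μ = g(δ*, ∇_δ Δ)`. -/
def mu (e : Tetrad) (f : ℂ → ℝ → ℂ) (p : Pt) : ℂ :=
  ip (metric f) e.deltaBar (cov (metric f) e.delta e.Delta) p

/-- The curvature scalar `Ψ₄ = C(Δ, δ*, Δ, δ*)`. For a null tetrad the Weyl tensor and the Riemann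
tensor have the same value on these arguments, because `g` vanishes on the span of `Δ, δ*`. -/
def Psi4 (e : Tetrad) (f : ℂ → ℝ → ℂ) (p : Pt) : ℂ :=
  curv (metric f) e.Delta e.deltaBar e.Delta e.deltaBar p

/-- The conjugate `α*` of the spin coefficient `α`. -/
def alphaStar (e : Tetrad) (f : ℂ → ℝ → ℂ) (p : Pt) : ℂ := conj (e.alpha f p)

/-- The invariant `A = δ* α / α²`. -/
def invA (e : Tetrad) (f : ℂ → ℝ → ℂ) (p : Pt) : ℂ :=
  along e.deltaBar (e.alpha f) p / e.alpha f p ^ 2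

/-- The invariant `B = μ A - μ*`. -/
def invB (e : Tetrad) (f : ℂ → ℝ → ℂ) (p : Pt) : ℂ :=
  e.mu f p * e.invA f p - conj (e.mu f p)

/-- `e` is a smooth null tetrad on `U` for the metric `2 θ¹ θ² - 2 θ³ θ⁴` (`θ` dual to
`δ, δ*, Δ, D`), whose vector `D` is aligned with the covariantly constant null vector field `∂_v`,
and which is normalized by `Ψ₄ = 1`, `γ = 0`. -/
structure IsNormalized (e : Tetrad) (f : ℂ → ℝ → ℂ) (U : Set Pt) : Prop where
  smooth_delta : ContDiffOn ℝ ∞ e.delta U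
  smooth_Delta : ContDiffOn ℝ ∞ e.Delta U
  smooth_D : ContDiffOn ℝ ∞ e.D U
  real_Delta : ∀ p ∈ U, cvf e.Delta p = e.Delta p
  real_D : ∀ p ∈ U, cvf e.D p = e.D p
  delta_delta : ∀ p ∈ U, ip (metric f) e.delta e.delta p = 0
  delta_deltaBar : ∀ p ∈ U, ip (metric f) e.delta e.deltaBar p = 1
  delta_Delta : ∀ p ∈ U, ip (metric f) e.delta e.Delta p = 0
  delta_D : ∀ p ∈ U, ip (metric f) e.delta e.D p = 0
  Delta_Delta : ∀ p ∈ U, ip (metric f) e.Delta e.Delta p = 0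
  D_D : ∀ p ∈ U, ip (metric f) e.D e.D p = 0
  Delta_D : ∀ p ∈ U, ip (metric f) e.Delta e.D p = -1
  aligned : ∀ p ∈ U, e.D p 0 = 0 ∧ e.D p 1 = 0 ∧ e.D p 2 = 0
  psi4 : ∀ p ∈ U, e.Psi4 f p = 1
  gamma_zero : ∀ p ∈ U, e.gamma f p = 0

end Tetrad

/-- Type `(0,1)`, in the branch `α ≠ 0`: the first order invariants `α` and `α*` are functionally
dependent. -/
def IsType01 (f : ℂ → ℝ → ℂ) (e : Tetrad) (U : Set Pt) : Prop :=
  (∀ p ∈ U, e.alpha f p ≠ 0) ∧ WedgeZeroOn (e.alpha f) (e.alphaStar f) U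

/-! ### Solution forms

`W` is a set of pairs `(ζ, u)` and `J` the interval in which `u` ranges.  Powers and logarithms are
taken with respect to an arbitrary continuous branch `ℓ` of the logarithm over `W`. -/

/-- `f = (k₀ e^{ih} ζ)^{2 i k₁} + g ζ`, with `h = h(u)` real and `g = g(u)` complex. -/
def FormP (k₀ k₁ : ℝ) (W : Set (ℂ × ℝ)) (J : Set ℝ) (f : ℂ → ℝ → ℂ) : Prop :=
  ∃ (h : ℝ → ℝ) (g : ℝ → ℂ) (ℓ : ℂ × ℝ → ℂ),
    ContDiffOn ℝ ∞ h J ∧ ContDiffOn ℝ ∞ g J ∧ ContinuousOn ℓ W ∧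
    (∀ q ∈ W, Complex.exp (ℓ q) = (k₀ : ℂ) * Complex.exp (Complex.I * (h q.2 : ℂ)) * q.1) ∧
    ∀ q ∈ W, f q.1 q.2 = Complex.exp (2 * Complex.I * (k₁ : ℂ) * ℓ q) + g q.2 * q.1

/-- `f = exp (k e^{ih} ζ) + g ζ`, with `h = h(u)` real and `g = g(u)` complex. -/
def FormE (k : ℝ) (W : Set (ℂ × ℝ)) (J : Set ℝ) (f : ℂ → ℝ → ℂ) : Prop :=
  ∃ (h : ℝ → ℝ) (g : ℝ → ℂ), ContDiffOn ℝ ∞ h J ∧ ContDiffOn ℝ ∞ g J ∧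
    ∀ q ∈ W, f q.1 q.2 =
      Complex.exp ((k : ℂ) * Complex.exp (Complex.I * (h q.2 : ℂ)) * q.1) + g q.2 * q.1

/-- `f = e^{ik} h log ζ + g ζ`, with `h = h(u) ≠ 0` real and `g = g(u)` complex. -/
def FormL (k : ℝ) (W : Set (ℂ × ℝ)) (J : Set ℝ) (f : ℂ → ℝ → ℂ) : Prop :=
  ∃ (h : ℝ → ℝ) (g : ℝ → ℂ) (ℓ : ℂ × ℝ → ℂ),
    ContDiffOn ℝ ∞ h J ∧ ContDiffOn ℝ ∞ g J ∧ (∀ u ∈ J, h u ≠ 0) ∧ ContinuousOn ℓ W ∧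
    (∀ q ∈ W, Complex.exp (ℓ q) = q.1) ∧
    ∀ q ∈ W, f q.1 q.2 =
      Complex.exp (Complex.I * (k : ℂ)) * (h q.2 : ℂ) * ℓ q + g q.2 * q.1

/-- The coordinate change `ζ̂ = ζ + s(u)`, `û = u`, `v̂ = v + s'(u) ζ̄ + s̄'(u) ζ + w(u)`. -/
def change (s : ℝ → ℂ) (w : ℝ → ℝ) (p : Pt) : Pt :=
  ![(zeta p + s (p 2)).re, (zeta p + s (p 2)).im, p 2,
    p 3 + 2 * (conj (deriv s (p 2)) * zeta p).re + w (p 2)]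

/-- Near `q₀ = (ζ₀, u₀)` the pp-wave metric of `f` is carried by a form-preserving coordinate
change to the pp-wave metric of a function `fhat` that has the form `C`. -/
def HasFormNear (C : Set (ℂ × ℝ) → Set ℝ → (ℂ → ℝ → ℂ) → Prop) (f : ℂ → ℝ → ℂ)
    (U : Set Pt) (q₀ : ℂ × ℝ) : Prop :=
  ∃ r > 0, ∃ (N : Set (ℂ × ℝ)) (J : Set ℝ),
    J = Set.Ioo (q₀.2 - r) (q₀.2 + r) ∧ N = Metric.ball q₀.1 r ×ˢ J ∧ N ⊆ zu '' U ∧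
    ∃ (s : ℝ → ℂ) (w : ℝ → ℝ) (fhat : ℂ → ℝ → ℂ),
      ContDiffOn ℝ ∞ s J ∧ ContDiffOn ℝ ∞ w J ∧
      (∀ p : Pt, zu p ∈ N → ∀ i j : Fin 4, metric f p i j =
        ∑ k, ∑ l, pd i (fun q => change s w q k) p * pd j (fun q => change s w q l) p *
          metric fhat (change s w p) k l) ∧
      C ((fun q : ℂ × ℝ => (q.1 + s q.2, q.2)) '' N) J fhat

end PPWave

end

open scoped ContDiff ComplexConjugate

noncomputable section

namespace PPWave

open Complex Filter Topology

/-! ### Functions of `(ζ, u)` that are holomorphic in `ζ` -/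

/-! Write `φ = ∂²f/∂ζ²`, a prime for `∂_ζ`, and put `τ = φ/φ'`, `n = -φ_u/φ'`. Nullity of `δ` forces
`δ*` to be a multiple of `∂_ζ` or of `∂_ζ̄` modulo `∂_v`; by continuity the choice is the same on
all of the connected `U`, and exchanging `δ` and `δ*` conjugates every invariant, so `δ* = 2B ∂_ζ`
modulo `∂_v` may be assumed.

With `a` the `u`-component of `Δ`, the normalization then reads `2a²B²φ = 1`, `4BB̄ = 1`, and `γ =
0` says that `φ` is constant along `Δ`. This gives `α = B/(2τ)`, and differentiation yields `δ*α =
-(1 + 4τ')α²`, `δα = αα*`, `Δα = -a n' α`, `μ = a n̄'`. Hence `A = -1 - 4τ'`, and the wedge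
condition on the pairs `(δ*, δ)` and `(δ*, Δ)` says exactly `AA* = 1` and `n' = A n̄'`. The second
relation is `B = 0` for the invariant `B` (`Tetrad.IsOriented.of_isType01`).

Now `A` is holomorphic in `ζ` of modulus one, so `A' = 0`, and then `n'' = 0`. Equality of mixed
partials of `φ` gives `τ_u + nτ' = n'τ`; its `ζ`-derivative gives `A_u = 0`. So `A` is a constant
(`exists_profileData`), and `τ` is affine in `ζ` with slope `-(1 + A)/4`. Integrating `φ'/φ = 1/τ`
gives an exponential for `A = -1` and a power otherwise; the second primitive of the power is a
logarithm when `A = 1`. The `u`-dependence is governed by `ν = n'` with `ν = A ν̄`, which freezes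
one real quantity: `|τ|` in the exponential case, the phase of the coefficient in the other two.
That is where the constants come from, and connectedness makes them global. The remaining terms,
affine in `ζ`, are absorbed by the coordinate change and by `g`. -/

/-- The real linear map `(z, t) ↦ a z + b t`. -/
def pdMap (a b : ℂ) : ℂ × ℝ →L[ℝ] ℂ :=
  a • ContinuousLinearMap.fst ℝ ℂ ℝ +
    b • (Complex.ofRealCLM ∘L ContinuousLinearMap.snd ℝ ℂ ℝ)

@[simp] lemma pdMap_apply (a b : ℂ) (v : ℂ × ℝ) : pdMap a b v = a * v.1 + b * v.2 := by
  simp [pdMap]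

/-- `Φ` has at `q` the partial derivatives `a` (complex, in `ζ`) and `b` (in `u`). -/
def HasPD (Φ : ℂ × ℝ → ℂ) (a b : ℂ) (q : ℂ × ℝ) : Prop := HasFDerivAt Φ (pdMap a b) q

lemma pdMap_inj {a b a' b' : ℂ} (h : pdMap a b = pdMap a' b') : a = a' ∧ b = b' := by
  have h1 := DFunLike.congr_fun h (1, 0)
  have h2 := DFunLike.congr_fun h (0, 1)
  simp at h1 h2
  exact ⟨h1, h2⟩

namespace HasPD

variable {Φ Ψ : ℂ × ℝ → ℂ} {a b a' b' : ℂ} {q : ℂ × ℝ}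

lemma unique (h : HasPD Φ a b q) (h' : HasPD Φ a' b' q) : a = a' ∧ b = b' :=
  pdMap_inj (HasFDerivAt.unique h h')

lemma congr (h : HasPD Φ a b q) (e : Ψ =ᶠ[𝓝 q] Φ) : HasPD Ψ a b q :=
  HasFDerivAt.congr_of_eventuallyEq h e

lemma cast (h : HasPD Φ a b q) (ha : a = a') (hb : b = b') : HasPD Φ a' b' q := ha ▸ hb ▸ h

lemma const (c : ℂ) (q : ℂ × ℝ) : HasPD (fun _ => c) 0 0 q := by
  have : pdMap 0 0 = 0 := by ext <;> simp
  rw [HasPD, this]; exact hasFDerivAt_const c q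

lemma fst (q : ℂ × ℝ) : HasPD (fun q => q.1) 1 0 q := by
  have : pdMap 1 0 = ContinuousLinearMap.fst ℝ ℂ ℝ := by ext <;> simp
  rw [HasPD, this]; exact hasFDerivAt_fst

lemma add (h : HasPD Φ a b q) (h' : HasPD Ψ a' b' q) :
    HasPD (fun q => Φ q + Ψ q) (a + a') (b + b') q := by
  refine (HasFDerivAt.add h h').congr_fderiv ?_
  ext <;> simp [add_mul]

lemma sub (h : HasPD Φ a b q) (h' : HasPD Ψ a' b' q) :
    HasPD (fun q => Φ q - Ψ q) (a - a') (b - b') q := by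
  refine (HasFDerivAt.sub h h').congr_fderiv ?_
  ext <;> simp [sub_mul]

lemma mul (h : HasPD Φ a b q) (h' : HasPD Ψ a' b' q) :
    HasPD (fun q => Φ q * Ψ q) (a * Ψ q + Φ q * a') (b * Ψ q + Φ q * b') q := by
  refine (HasFDerivAt.mul h h').congr_fderiv ?_
  ext <;> simp <;> ring

lemma comp {k : ℂ → ℂ} {k' : ℂ} (h : HasPD Φ a b q) (hk : HasDerivAt k k' (Φ q)) :
    HasPD (fun q => k (Φ q)) (k' * a) (k' * b) q := by
  refine ((hk.hasFDerivAt.restrictScalars ℝ).comp q h).congr_fderiv ?_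
  ext <;> simp <;> ring

lemma inv (h : HasPD Φ a b q) (h0 : Φ q ≠ 0) :
    HasPD (fun q => (Φ q)⁻¹) (-a / Φ q ^ 2) (-b / Φ q ^ 2) q :=
  (h.comp (hasDerivAt_inv h0)).cast (by ring) (by ring)

lemma div (h : HasPD Φ a b q) (h' : HasPD Ψ a' b' q) (h0 : Ψ q ≠ 0) :
    HasPD (fun q => Φ q / Ψ q) ((a * Ψ q - Φ q * a') / Ψ q ^ 2)
      ((b * Ψ q - Φ q * b') / Ψ q ^ 2) q := by
  simp only [div_eq_mul_inv]
  refine (h.mul (h'.inv h0)).cast ?_ ?_ <;> field_simp <;> ring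

lemma exp (h : HasPD Φ a b q) :
    HasPD (fun q => Complex.exp (Φ q)) (Complex.exp (Φ q) * a) (Complex.exp (Φ q) * b) q :=
  h.comp (Complex.hasDerivAt_exp _)

lemma log (h : HasPD Φ a b q) (h0 : Φ q ∈ slitPlane) :
    HasPD (fun q => Complex.log (Φ q)) (a / Φ q) (b / Φ q) q :=
  (h.comp (Complex.hasDerivAt_log h0)).cast (by ring) (by ring)

lemma hasFDerivAt_conj (h : HasPD Φ a b q) :
    HasFDerivAt (fun q => starRingEnd ℂ (Φ q)) ((conjCLE : ℂ →L[ℝ] ℂ) ∘L pdMap a b) q :=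
  (conjCLE : ℂ →L[ℝ] ℂ).hasFDerivAt.comp q h

/-- Comparison of the linear and antilinear parts of the derivatives in `Φ = K Ψ̄`. -/
lemma of_eq_mul_conj {K : ℂ × ℝ → ℂ} {a'' b'' : ℂ} (h : HasPD Φ a b q) (hK : HasPD K a'' b'' q)
    (h' : HasPD Ψ a' b' q) (e : ∀ᶠ x in 𝓝 q, Φ x = K x * starRingEnd ℂ (Ψ x)) :
    a = a'' * starRingEnd ℂ (Ψ q) ∧ K q * starRingEnd ℂ a' = 0 ∧
      b = b'' * starRingEnd ℂ (Ψ q) + K q * starRingEnd ℂ b' := by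
  have h1 := HasFDerivAt.mul hK (hasFDerivAt_conj h')
  have h2 := HasFDerivAt.unique h (h1.congr_of_eventuallyEq e)
  have e1 := DFunLike.congr_fun h2 (1, 0)
  have e2 := DFunLike.congr_fun h2 (I, 0)
  have e3 := DFunLike.congr_fun h2 (0, 1)
  simp at e1 e2 e3
  have e4 : a = K q * -(starRingEnd ℂ) a' + starRingEnd ℂ (Ψ q) * a'' := by
    have := congrArg (fun z => -I * z) e2
    ring_nf at this
    simp only [I_sq] at this
    linear_combination this
  refine ⟨?_, ?_, ?_⟩
  · linear_combination (e1 + e4) / 2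
  · linear_combination (e4 - e1) / 2
  · linear_combination e3

end HasPD

/-- The complex derivative in `ζ`. -/
def dz (Φ : ℂ × ℝ → ℂ) (q : ℂ × ℝ) : ℂ := fderiv ℝ Φ q (1, 0)

/-- The derivative in `u`. -/
def du (Φ : ℂ × ℝ → ℂ) (q : ℂ × ℝ) : ℂ := fderiv ℝ Φ q (0, 1)

/-- `Φ` is smooth in `(ζ, u)` and holomorphic in `ζ`. -/
structure HolOn (Φ : ℂ × ℝ → ℂ) (W : Set (ℂ × ℝ)) : Prop where
  smooth : ContDiffOn ℝ ∞ Φ W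
  cr : ∀ q ∈ W, fderiv ℝ Φ q (I, 0) = I * fderiv ℝ Φ q (1, 0)

lemma HasPD.dz_eq {Φ : ℂ × ℝ → ℂ} {a b : ℂ} {q : ℂ × ℝ} (h : HasPD Φ a b q) : dz Φ q = a := by
  rw [dz, HasFDerivAt.fderiv h]; simp

lemma HasPD.du_eq {Φ : ℂ × ℝ → ℂ} {a b : ℂ} {q : ℂ × ℝ} (h : HasPD Φ a b q) : du Φ q = b := by
  rw [du, HasFDerivAt.fderiv h]; simp

namespace HolOn

variable {Φ Ψ : ℂ × ℝ → ℂ} {W V : Set (ℂ × ℝ)} {q : ℂ × ℝ}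

lemma mono (h : HolOn Φ W) (hVW : V ⊆ W) : HolOn Φ V :=
  ⟨h.smooth.mono hVW, fun q hq => h.cr q (hVW hq)⟩

lemma contDiffAt (h : HolOn Φ W) (hW : IsOpen W) (hq : q ∈ W) : ContDiffAt ℝ ∞ Φ q :=
  h.smooth.contDiffAt (hW.mem_nhds hq)

lemma hasPD (h : HolOn Φ W) (hW : IsOpen W) (hq : q ∈ W) : HasPD Φ (dz Φ q) (du Φ q) q := by
  have hd := ((h.contDiffAt hW hq).differentiableAt (by simp)).hasFDerivAt
  refine hd.congr_fderiv ?_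
  have h1 := h.cr q hq
  refine ContinuousLinearMap.ext fun v => ?_
  obtain ⟨⟨x, y⟩, t⟩ := v
  have hz : (⟨x, y⟩ : ℂ) = x + y * I := by apply Complex.ext <;> simp
  have hv : ((⟨x, y⟩, t) : ℂ × ℝ) = x • ((1 : ℂ), (0 : ℝ)) + y • (I, 0) + t • ((0 : ℂ), (1 : ℝ)) := by
    ext <;> simp [hz]
  rw [pdMap_apply, hv, map_add, map_add, map_smul, map_smul, map_smul, h1, ← hv]
  simp only [hz, dz, du, Complex.real_smul]
  ring

lemma of_hasPD {a b : ℂ × ℝ → ℂ} (hs : ContDiffOn ℝ ∞ Φ W) (h : ∀ q ∈ W, HasPD Φ (a q) (b q) q) :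
    HolOn Φ W :=
  ⟨hs, fun q hq => by rw [HasFDerivAt.fderiv (h q hq)]; simp [mul_comm]⟩

lemma congr (h : HolOn Φ W) (hW : IsOpen W) (e : Set.EqOn Ψ Φ W) : HolOn Ψ W :=
  of_hasPD (a := dz Φ) (b := du Φ) (h.smooth.congr e) fun _ hq =>
    (h.hasPD hW hq).congr (e.eventuallyEq_of_mem (hW.mem_nhds hq))

lemma const (c : ℂ) (W : Set (ℂ × ℝ)) : HolOn (fun _ => c) W :=
  of_hasPD contDiffOn_const fun q _ => HasPD.const c q

lemma fst (W : Set (ℂ × ℝ)) : HolOn (fun q => q.1) W :=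
  of_hasPD contDiffOn_fst fun q _ => HasPD.fst q

lemma add (h : HolOn Φ W) (h' : HolOn Ψ W) (hW : IsOpen W) : HolOn (fun q => Φ q + Ψ q) W :=
  of_hasPD (h.smooth.add h'.smooth) fun _ hq => (h.hasPD hW hq).add (h'.hasPD hW hq)

lemma sub (h : HolOn Φ W) (h' : HolOn Ψ W) (hW : IsOpen W) : HolOn (fun q => Φ q - Ψ q) W :=
  of_hasPD (h.smooth.sub h'.smooth) fun _ hq => (h.hasPD hW hq).sub (h'.hasPD hW hq)

lemma mul (h : HolOn Φ W) (h' : HolOn Ψ W) (hW : IsOpen W) : HolOn (fun q => Φ q * Ψ q) W :=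
  of_hasPD (h.smooth.mul h'.smooth) fun _ hq => (h.hasPD hW hq).mul (h'.hasPD hW hq)

lemma div (h : HolOn Φ W) (h' : HolOn Ψ W) (hW : IsOpen W) (h0 : ∀ q ∈ W, Ψ q ≠ 0) :
    HolOn (fun q => Φ q / Ψ q) W :=
  of_hasPD (by simp only [div_eq_mul_inv]; exact h.smooth.mul (h'.smooth.inv h0)) fun q hq =>
    (h.hasPD hW hq).div (h'.hasPD hW hq) (h0 q hq)

lemma log (h : HolOn Φ W) (hW : IsOpen W) (h0 : ∀ q ∈ W, Φ q ∈ slitPlane) :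
    HolOn (fun q => Complex.log (Φ q)) W :=
  of_hasPD (fun q hq => ((contDiffAt_log (h0 q hq)).restrict_scalars ℝ |>.comp_contDiffWithinAt q
    (h.smooth q hq))) fun q hq => (h.hasPD hW hq).log (h0 q hq)

lemma exp (h : HolOn Φ W) (hW : IsOpen W) : HolOn (fun q => Complex.exp (Φ q)) W :=
  of_hasPD h.smooth.cexp fun _ hq => (h.hasPD hW hq).exp

lemma smooth_fderiv (h : HolOn Φ W) (hW : IsOpen W) (v : ℂ × ℝ) :
    ContDiffOn ℝ ∞ (fun q => fderiv ℝ Φ q v) W :=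
  (h.smooth.fderiv_of_isOpen hW (by simp)).clm_apply contDiffOn_const

lemma fderiv_comm (h : HolOn Φ W) (hW : IsOpen W) (hq : q ∈ W) (v w : ℂ × ℝ) :
    fderiv ℝ (fun x => fderiv ℝ Φ x v) q w = fderiv ℝ (fun x => fderiv ℝ Φ x w) q v := by
  have hc := h.contDiffAt hW hq
  have hs : IsSymmSndFDerivAt ℝ Φ q := hc.isSymmSndFDerivAt (by simpa using WithTop.coe_le_coe.2 (le_top : (2 : ℕ∞) ≤ ⊤))
  have hd : DifferentiableAt ℝ (fderiv ℝ Φ) q :=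
    (hc.fderiv_right (m := 1) (by norm_cast)).differentiableAt (by simp)
  have key : ∀ v w, fderiv ℝ (fun x => fderiv ℝ Φ x v) q w = fderiv ℝ (fderiv ℝ Φ) q w v := by
    intro v w
    rw [fderiv_clm_apply hd (by fun_prop)]
    simp
  rw [key, key]
  exact hs w v

/-- Symmetry of the second derivative carries the Cauchy–Riemann equation through differentiation in
any direction, in particular in `u`. -/
lemma fderiv_apply (h : HolOn Φ W) (hW : IsOpen W) (v : ℂ × ℝ) :
    HolOn (fun q => fderiv ℝ Φ q v) W := by
  refine ⟨h.smooth_fderiv hW v, fun q hq => ?_⟩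
  have e : (fun x => fderiv ℝ Φ x (I, 0)) =ᶠ[𝓝 q] fun x => I * fderiv ℝ Φ x (1, 0) := by
    filter_upwards [hW.mem_nhds hq] with x hx using h.cr x hx
  have hd : DifferentiableAt ℝ (fun x => fderiv ℝ Φ x (1, 0)) q :=
    ((h.smooth_fderiv hW (1, 0)).contDiffAt (hW.mem_nhds hq)).differentiableAt (by simp)
  rw [h.fderiv_comm hW hq, e.fderiv_eq, fderiv_const_mul hd, h.fderiv_comm hW hq v]
  simp

lemma dz (h : HolOn Φ W) (hW : IsOpen W) : HolOn (dz Φ) W := h.fderiv_apply hW _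

lemma du (h : HolOn Φ W) (hW : IsOpen W) : HolOn (du Φ) W := h.fderiv_apply hW _

lemma dz_du (h : HolOn Φ W) (hW : IsOpen W) (hq : q ∈ W) :
    PPWave.dz (PPWave.du Φ) q = PPWave.du (PPWave.dz Φ) q := h.fderiv_comm hW hq _ _

end HolOn

/-- On a product of a disc and an interval, a function with vanishing `ζ`-derivative depends on `u`
only. -/
lemma exists_of_dz_eq_zero {Φ : ℂ × ℝ → ℂ} {z₀ : ℂ} {r : ℝ} {J : Set ℝ} (hr : 0 < r)
    (hJ : IsOpen J) (h : HolOn Φ (Metric.ball z₀ r ×ˢ J))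
    (h0 : ∀ q ∈ Metric.ball z₀ r ×ˢ J, dz Φ q = 0) :
    ∃ G : ℝ → ℂ, ContDiffOn ℝ ∞ G J ∧ ∀ q ∈ Metric.ball z₀ r ×ˢ J, Φ q = G q.2 := by
  refine ⟨fun u => Φ (z₀, u), ?_, ?_⟩
  · exact h.smooth.comp (by fun_prop) fun u hu => ⟨Metric.mem_ball_self hr, hu⟩
  · rintro ⟨z, u⟩ ⟨hz, hu⟩
    have hopen := Metric.isOpen_ball.prod hJ (s := Metric.ball z₀ r)
    have hd : ∀ x ∈ Metric.ball z₀ r, HasFDerivAt (fun x => Φ (x, u)) (0 : ℂ →L[ℝ] ℂ) x := by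
      intro x hx
      replace hu : u ∈ J := hu
      have h1 := h.hasPD hopen (q := (x, u)) ⟨hx, hu⟩
      rw [h0 (x, u) ⟨hx, hu⟩] at h1
      refine ((show HasFDerivAt Φ _ (x, u) from h1).comp x
        (hasFDerivAt_prodMk_left x u)).congr_fderiv ?_
      ext
      simp
    exact (convex_ball z₀ r).is_const_of_fderivWithin_eq_zero (𝕜 := ℝ)
      (fun x hx => (hd x hx).differentiableAt.differentiableWithinAt)
      (fun x hx => (hd x hx).hasFDerivWithinAt.fderivWithin
        (Metric.isOpen_ball.uniqueDiffWithinAt hx)) hz (Metric.mem_ball_self hr)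

/-- A function with vanishing derivative on a connected open set is constant. -/
lemma eq_of_hasFDerivAt_zero {Φ : ℂ × ℝ → ℂ} {W : Set (ℂ × ℝ)} (hW : IsOpen W)
    (hc : IsPreconnected W) (h : ∀ q ∈ W, HasFDerivAt Φ (0 : ℂ × ℝ →L[ℝ] ℂ) q)
    {p q : ℂ × ℝ} (hp : p ∈ W) (hq : q ∈ W) : Φ p = Φ q :=
  hW.is_const_of_fderiv_eq_zero hc
    (fun x hx => (h x hx).differentiableAt.differentiableWithinAt)
    (fun x hx => (h x hx).fderiv) hp hq

/-! ### Form-preserving coordinate changes -/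

lemma exists_contDiffOn_primitive {k : ℝ → ℝ} {a b : ℝ} (hk : ContDiffOn ℝ ∞ k (Set.Ioo a b)) :
    ∃ w : ℝ → ℝ, ContDiffOn ℝ ∞ w (Set.Ioo a b) ∧ ∀ u ∈ Set.Ioo a b, HasDerivAt w (k u) u := by
  by_cases hab : a < b
  swap
  · exact ⟨0, contDiffOn_const, fun u hu => absurd (hu.1.trans hu.2) hab⟩
  obtain ⟨c, hc⟩ := Set.nonempty_Ioo.2 hab
  have hd : ∀ u ∈ Set.Ioo a b, HasDerivAt (fun u => ∫ t in c..u, k t) (k u) u := by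
    intro u hu
    have hsub : Set.uIcc c u ⊆ Set.Ioo a b := Set.ordConnected_Ioo.uIcc_subset hc hu
    exact intervalIntegral.integral_hasDerivAt_right
      ((hk.continuousOn.mono hsub).intervalIntegrable)
      (hk.continuousOn.stronglyMeasurableAtFilter isOpen_Ioo u hu)
      (hk.continuousOn.continuousAt (isOpen_Ioo.mem_nhds hu))
  refine ⟨fun u => ∫ t in c..u, k t, ?_, hd⟩
  rw [contDiffOn_infty_iff_deriv_of_isOpen isOpen_Ioo]
  exact ⟨fun u hu => (hd u hu).differentiableAt.differentiableWithinAt,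
    hk.congr fun u hu => (hd u hu).deriv⟩

lemma hasFDerivAt_coord (i : Fin 4) (p : Pt) :
    HasFDerivAt (fun q : Pt => q i) (ContinuousLinearMap.proj (R := ℝ) i) p :=
  hasFDerivAt_apply i p

/-- The Jacobian matrix of the coordinate change, row `k` holding the derivatives of the `k`-th
new coordinate. -/
lemma pd_change {s : ℝ → ℂ} {w : ℝ → ℝ} {p : Pt} {s' s'' : ℂ} {w' : ℝ}
    (hs : HasDerivAt s s' (p 2)) (hs' : HasDerivAt (deriv s) s'' (p 2))
    (hw : HasDerivAt w w' (p 2)) (k i : Fin 4) :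
    pd i (fun q => change s w q k) p =
      (!![1, 0, s'.re, 0; 0, 1, s'.im, 0; 0, 0, 1, 0;
        2 * s'.re, 2 * s'.im, 2 * (s''.re * p 0 + s''.im * p 1) + w', 1] :
          Matrix (Fin 4) (Fin 4) ℝ) k i := by
  have hre : HasDerivAt (fun t => (s t).re) s'.re (p 2) := reCLM.hasFDerivAt.comp_hasDerivAt _ hs
  have him : HasDerivAt (fun t => (s t).im) s'.im (p 2) := imCLM.hasFDerivAt.comp_hasDerivAt _ hs
  have hre' : HasDerivAt (fun t => (deriv s t).re) s''.re (p 2) :=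
    reCLM.hasFDerivAt.comp_hasDerivAt _ hs'
  have him' : HasDerivAt (fun t => (deriv s t).im) s''.im (p 2) :=
    imCLM.hasFDerivAt.comp_hasDerivAt _ hs'
  have h0 := hasFDerivAt_coord 0 p
  have h1 := hasFDerivAt_coord 1 p
  have h2 := hasFDerivAt_coord 2 p
  have h3 := hasFDerivAt_coord 3 p
  have c0 := h0.add (hre.hasFDerivAt.comp p h2)
  have c1 := h1.add (him.hasFDerivAt.comp p h2)
  have c3 := (h3.add (((((hre'.hasFDerivAt.comp p h2).mul h0).add
    ((him'.hasFDerivAt.comp p h2).mul h1))).const_mul 2)).add (hw.hasFDerivAt.comp p h2)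
  have e0 : (fun q : Pt => change s w q 0) = fun q => q 0 + (s (q 2)).re := by
    funext q; simp [change, zeta]
  have e1 : (fun q : Pt => change s w q 1) = fun q => q 1 + (s (q 2)).im := by
    funext q; simp [change, zeta]
  have e2 : (fun q : Pt => change s w q 2) = fun q => q 2 := by
    funext q; simp [change]
  have e3 : (fun q : Pt => change s w q 3) = fun q => q 3 +
      2 * ((deriv s (q 2)).re * q 0 + (deriv s (q 2)).im * q 1) + w (q 2) := by
    funext q; simp [change, zeta]
  have f0 := HasFDerivAt.fderiv c0
  have f1 := HasFDerivAt.fderiv c1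
  have f3 := HasFDerivAt.fderiv c3
  fin_cases k
  · change fderiv ℝ (fun q : Pt => change s w q 0) p _ = _
    rw [e0]; erw [f0]
    fin_cases i <;> simp
  · change fderiv ℝ (fun q : Pt => change s w q 1) p _ = _
    rw [e1]; erw [f1]
    fin_cases i <;> simp
  · change fderiv ℝ (fun q : Pt => change s w q 2) p _ = _
    rw [e2, h2.fderiv]
    fin_cases i <;> simp
  · change fderiv ℝ (fun q : Pt => change s w q 3) p _ = _
    rw [e3]; erw [f3]
    (fin_cases i <;> simp [hs.deriv]); ring

/-- The off-diagonal terms match for any `s` and `w` by the choice of the `v`-shift, so the only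
condition left is the one on the coefficient of `du²`. -/
lemma metric_change {f fhat : ℂ → ℝ → ℂ} {s : ℝ → ℂ} {w : ℝ → ℝ} {p : Pt} {s' s'' : ℂ} {w' : ℝ}
    (hs : HasDerivAt s s' (p 2)) (hs' : HasDerivAt (deriv s) s'' (p 2))
    (hw : HasDerivAt w w' (p 2))
    (h : (f (zeta p) (p 2)).re = (fhat (zeta p + s (p 2)) (p 2)).re - normSq s' +
      2 * (conj s'' * zeta p).re + w') (i j : Fin 4) :
    metric f p i j = ∑ k, ∑ l, pd i (fun q => change s w q k) p *
      pd j (fun q => change s w q l) p * metric fhat (change s w p) k l := by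
  have hz : zeta (change s w p) = zeta p + s (p 2) := by
    apply Complex.ext <;> simp [zeta, change]
  have h2 : change s w p 2 = p 2 := by simp [change]
  simp only [pd_change hs hs' hw, metric, hz, h2, h]
  simp only [normSq_apply, mul_re, conj_re, conj_im, zeta]
  fin_cases i <;> fin_cases j <;> simp [Fin.sum_univ_four] <;> ring

/-- A function `f(ζ, u) = F(ζ + s, u) + g₀ ζ + c₀` is carried to `F(ζ̂, u) + g ζ̂` by a
form-preserving coordinate change. -/
lemma hasFormNear_of_eq_add {C : Set (ℂ × ℝ) → Set ℝ → (ℂ → ℝ → ℂ) → Prop} {f F : ℂ → ℝ → ℂ}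
    {U : Set Pt} {q₀ : ℂ × ℝ} {r : ℝ} (hr : 0 < r) {J : Set ℝ}
    (hJ : J = Set.Ioo (q₀.2 - r) (q₀.2 + r)) (hN : Metric.ball q₀.1 r ×ˢ J ⊆ zu '' U)
    {s g₀ c₀ : ℝ → ℂ} (hs : ContDiffOn ℝ ∞ s J) (hg₀ : ContDiffOn ℝ ∞ g₀ J)
    (hc₀ : ContDiffOn ℝ ∞ c₀ J)
    (hf : ∀ q ∈ Metric.ball q₀.1 r ×ˢ J,
      f q.1 q.2 = F (q.1 + s q.2) q.2 + g₀ q.2 * q.1 + c₀ q.2)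
    (hC : ∀ g : ℝ → ℂ, ContDiffOn ℝ ∞ g J →
      C ((fun q : ℂ × ℝ => (q.1 + s q.2, q.2)) '' (Metric.ball q₀.1 r ×ˢ J)) J
        (fun z u => F z u + g u * z)) :
    HasFormNear C f U q₀ := by
  have hJo : IsOpen J := hJ ▸ isOpen_Ioo
  have hs1 : ContDiffOn ℝ ∞ (deriv s) J := ((contDiffOn_infty_iff_deriv_of_isOpen hJo).1 hs).2
  have hs2 : ContDiffOn ℝ ∞ (deriv (deriv s)) J :=
    ((contDiffOn_infty_iff_deriv_of_isOpen hJo).1 hs1).2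
  -- The `du²` condition contains `2 Re(s̄'' ζ)`; `g` is chosen so that the terms linear in `ζ`
  -- balance. The part independent of `ζ` is left to `w'`, and only its real part matters because
  -- the metric sees `Re f` alone.
  set g : ℝ → ℂ := fun u => g₀ u - 2 * conj (deriv (deriv s) u) with hgdef
  have hconj : ∀ {t : ℝ → ℂ}, ContDiffOn ℝ ∞ t J → ContDiffOn ℝ ∞ (fun u => conj (t u)) J :=
    fun ht => conjCLE.contDiff.comp_contDiffOn ht
  have hg : ContDiffOn ℝ ∞ g J := hg₀.sub (contDiffOn_const.mul (hconj hs2))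
  have hk : ContDiffOn ℝ ∞ (fun u => (c₀ u - g u * s u + deriv s u * conj (deriv s u)).re) J :=
    reCLM.contDiff.comp_contDiffOn ((hc₀.sub (hg.mul hs)).add (hs1.mul (hconj hs1)))
  obtain ⟨w, hw, hw'⟩ := exists_contDiffOn_primitive (hJ ▸ hk)
  rw [← hJ] at hw hw'
  refine ⟨r, hr, _, J, hJ, rfl, hN, s, w, fun z u => F z u + g u * z, hs, hw, ?_, hC g hg⟩
  intro p hp i j
  have hpJ : p 2 ∈ J := hp.2
  have hd : ∀ {t : ℝ → ℂ}, ContDiffOn ℝ ∞ t J → HasDerivAt t (deriv t (p 2)) (p 2) := fun ht =>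
    ((ht.contDiffAt (hJo.mem_nhds hpJ)).differentiableAt (by simp)).hasDerivAt
  refine metric_change (hd hs) (hd hs1) (hw' _ hpJ) ?_ i j
  have := hf _ hp
  simp only [zu] at this
  rw [this]
  simp only [hgdef, normSq_apply, mul_re, add_re, sub_re, conj_re, conj_im, add_im, sub_im, mul_im,
    re_ofNat, im_ofNat]
  ring

/-! ### Classification of the profile functions -/

lemma exists_box {P : ℂ × ℝ → Prop} {q₀ : ℂ × ℝ} (h : ∀ᶠ q in 𝓝 q₀, P q) :
    ∃ r > 0, ∀ q ∈ Metric.ball q₀.1 r ×ˢ Set.Ioo (q₀.2 - r) (q₀.2 + r), P q := by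
  obtain ⟨r, hr, h⟩ := Metric.eventually_nhds_iff_ball.1 h
  refine ⟨r, hr, fun q hq => h q ?_⟩
  -- The product carries the sup metric, so a ball in it is a disc times an interval.
  rw [← Real.ball_eq_Ioo, ball_prod_same] at hq
  exact hq

/-- A product `Φ Ψ̄` is stationary when its linear, antilinear and `u` parts vanish separately. It
serves to show that `τ τ̄` and `T / T̄` are constant. -/
lemma HasPD.hasFDerivAt_mul_conj {Φ Ψ : ℂ × ℝ → ℂ} {a b a' b' : ℂ} {q : ℂ × ℝ}
    (h : HasPD Φ a b q) (h' : HasPD Ψ a' b' q) (e1 : a * conj (Ψ q) = 0)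
    (e2 : Φ q * conj a' = 0) (e3 : b * conj (Ψ q) + Φ q * conj b' = 0) :
    HasFDerivAt (fun q => Φ q * conj (Ψ q)) (0 : ℂ × ℝ →L[ℝ] ℂ) q := by
  refine (HasFDerivAt.mul h (HasPD.hasFDerivAt_conj h')).congr_fderiv ?_
  refine ContinuousLinearMap.ext fun v => ?_
  simp
  linear_combination (conj v.1) * e2 + v.1 * e1 + v.2 * e3

lemma dz_dz_eq {Ψ a b c φ : ℂ × ℝ → ℂ} {W : Set (ℂ × ℝ)} (hW : IsOpen W)
    (h1 : ∀ q ∈ W, HasPD Ψ (a q) (b q) q) (h2 : ∀ q ∈ W, HasPD a (φ q) (c q) q) {q : ℂ × ℝ}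
    (hq : q ∈ W) : dz (dz Ψ) q = φ q :=
  ((h2 q hq).congr (by
    filter_upwards [hW.mem_nhds hq] with x hx using (h1 x hx).dz_eq)).dz_eq

/-- On a product of a disc and an interval, a function whose second `ζ`-derivative vanishes is
affine in `ζ`. -/
lemma exists_affine {Φ : ℂ × ℝ → ℂ} {z₀ : ℂ} {r : ℝ} {J : Set ℝ} (hr : 0 < r)
    (hJ : IsOpen J) (h : HolOn Φ (Metric.ball z₀ r ×ˢ J))
    (h0 : ∀ q ∈ Metric.ball z₀ r ×ˢ J, dz (dz Φ) q = 0) :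
    ∃ g c : ℝ → ℂ, ContDiffOn ℝ ∞ g J ∧ ContDiffOn ℝ ∞ c J ∧
      ∀ q ∈ Metric.ball z₀ r ×ˢ J, Φ q = g q.2 * q.1 + c q.2 := by
  have hN := Metric.isOpen_ball.prod hJ (s := Metric.ball z₀ r)
  obtain ⟨g, hg, hg'⟩ := exists_of_dz_eq_zero hr hJ (h.dz hN) h0
  have hd := (h.dz hN).mul (HolOn.fst _) hN
  obtain ⟨c, hc, hc'⟩ := exists_of_dz_eq_zero hr hJ (h.sub hd hN) (by
    intro q hq
    have := ((h.hasPD hN hq).sub (((h.dz hN).hasPD hN hq).mul (HasPD.fst q))).dz_eq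
    rw [this, h0 q hq]; ring)
  refine ⟨g, c, hg, hc, fun q hq => ?_⟩
  rw [← hc' q hq, ← hg' q hq]; ring

/-- The differential consequences of the type `(0,1)` conditions for `φ = ∂²f/∂ζ²`, in terms of
`τ = φ / φ'`, `n = - φ_u / φ'` and `ν = n'`, when the first invariant is the constant `A`. -/
structure ProfileData (F φ τ n ν : ℂ × ℝ → ℂ) (A : ℂ) (W : Set (ℂ × ℝ)) : Prop where
  isOpen : IsOpen W
  isPreconnected : IsPreconnected W
  holF : HolOn F W
  holφ : HolOn φ W
  holτ : HolOn τ W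
  dzF : ∀ q ∈ W, dz (dz F) q = φ q
  φ_ne : ∀ q ∈ W, φ q ≠ 0
  τ_ne : ∀ q ∈ W, τ q ≠ 0
  norm_A : A * conj A = 1
  ν_eq : ∀ q ∈ W, ν q = A * conj (ν q)
  pdφ : ∀ q ∈ W, HasPD φ (φ q / τ q) (-(n q * φ q) / τ q) q
  pdτ : ∀ q ∈ W, HasPD τ (-((1 + A) / 4)) (ν q * τ q + n q * ((1 + A) / 4)) q

/-- With `φ_u = -n φ'`, the function `τ = φ / φ'` satisfies `τ_u + n τ' = n' τ`. -/
lemma holOn_tau_n {φ τ n : ℂ × ℝ → ℂ} {W : Set (ℂ × ℝ)} (hW : IsOpen W) (hφ : HolOn φ W)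
    (h3 : ∀ q ∈ W, dz φ q ≠ 0) (hτ : ∀ q ∈ W, τ q = φ q / dz φ q)
    (hn : ∀ q ∈ W, n q = -du φ q / dz φ q) :
    HolOn τ W ∧ HolOn n W ∧ ∀ q ∈ W, du τ q = dz n q * τ q - n q * dz τ q := by
  have hφ' := hφ.dz hW
  have holτ : HolOn τ W := (hφ.div hφ' hW h3).congr hW hτ
  have holn : HolOn n W := by
    refine ((((HolOn.const (-1) W).mul (hφ.du hW) hW)).div hφ' hW h3).congr hW fun q hq => ?_
    simp only [hn q hq]; ring
  have ev : ∀ {P : ℂ × ℝ → Prop}, (∀ q ∈ W, P q) → ∀ q ∈ W, ∀ᶠ x in 𝓝 q, P x :=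
    fun h q hq => by filter_upwards [hW.mem_nhds hq] with x hx using h x hx
  refine ⟨holτ, holn, ?_⟩
  have φu : ∀ q ∈ W, du φ q = -(n q * dz φ q) := fun q hq => by
    have := h3 q hq
    rw [hn q hq]; field_simp
  -- This is `∂_ζ` of `φ_u = -nφ'`, with the mixed partials of `φ` exchanged.
  have φu' : ∀ q ∈ W, du (dz φ) q = -(dz n q * dz φ q + n q * dz (dz φ) q) := fun q hq => by
    have h1 := (((hφ.du hW).hasPD hW hq).congr (ev (fun x hx => (φu x hx).symm) q hq)).dz_eq
    rw [← hφ.dz_du hW hq, ← h1, ((HasPD.const (-1) q).mul ((holn.hasPD hW hq).mul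
      (hφ'.hasPD hW hq)) |>.congr (Eventually.of_forall fun x => by ring)).dz_eq]
    ring
  intro q hq
  have h0 := h3 q hq
  have h1 := ((hφ.hasPD hW hq).div (hφ'.hasPD hW hq) h0).congr (ev hτ q hq)
  have e1 : dz τ q = 1 - φ q * dz (dz φ) q / dz φ q ^ 2 := by
    rw [h1.dz_eq]; field_simp
  rw [e1, h1.du_eq, φu q hq, φu' q hq, hτ q hq]
  field_simp
  ring

/-- The type `(0,1)` conditions make `A` constant. -/
theorem exists_profileData {F : ℂ × ℝ → ℂ} {W : Set (ℂ × ℝ)} (hW : IsOpen W)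
    (hc : IsConnected W) (hF : HolOn F W) (h2 : ∀ q ∈ W, dz (dz F) q ≠ 0)
    (h3 : ∀ q ∈ W, dz (dz (dz F)) q ≠ 0) {A τ n : ℂ × ℝ → ℂ}
    (hτ : ∀ q ∈ W, τ q = dz (dz F) q / dz (dz (dz F)) q)
    (hn : ∀ q ∈ W, n q = -du (dz (dz F)) q / dz (dz (dz F)) q)
    (hA : ∀ q ∈ W, A q = -1 - 4 * dz τ q)
    (hA1 : ∀ q ∈ W, A q * conj (A q) = 1)
    (hν : ∀ q ∈ W, dz n q = A q * conj (dz n q)) :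
    ∃ A₀ : ℂ, (∀ q ∈ W, A q = A₀) ∧ ProfileData F (dz (dz F)) τ n (dz n) A₀ W := by
  set φ := dz (dz F) with hφdef
  have hφ : HolOn φ W := (hF.dz hW).dz hW
  obtain ⟨holτ, holn, hτu⟩ := holOn_tau_n hW hφ h3 hτ hn
  have holν := holn.dz hW
  have holA : HolOn A W :=
    ((HolOn.const (-1) W).sub ((HolOn.const 4 W).mul (holτ.dz hW) hW) hW).congr hW hA
  have ev : ∀ {P : ℂ × ℝ → Prop}, (∀ q ∈ W, P q) → ∀ q ∈ W, ∀ᶠ x in 𝓝 q, P x :=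
    fun h q hq => by filter_upwards [hW.mem_nhds hq] with x hx using h x hx
  have hA0 : ∀ q ∈ W, A q ≠ 0 := fun q hq h => by simpa [h] using hA1 q hq
  -- The `ζ`-linear part of the derivative of `1 = A Ā` is `A' Ā`, since `Ā` contributes only
  -- antilinearly.
  have dA : ∀ q ∈ W, dz A q = 0 := fun q hq => by
    have := (HasPD.of_eq_mul_conj (HasPD.const 1 q) (holA.hasPD hW hq) (holA.hasPD hW hq)
      (ev (fun x hx => (hA1 x hx).symm) q hq)).1
    have hc0 : conj (A q) ≠ 0 := by simpa using hA0 q hq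
    exact (mul_eq_zero.1 this.symm).resolve_right hc0
  -- The same comparison in `n' = A n̄'`, where `A' = 0` is now known.
  have dν : ∀ q ∈ W, dz (dz n) q = 0 := fun q hq => by
    have := (HasPD.of_eq_mul_conj (holν.hasPD hW hq) (holA.hasPD hW hq) (holν.hasPD hW hq)
      (ev hν q hq)).1
    rw [this, dA q hq, zero_mul]
  have dτ : ∀ q ∈ W, dz τ q = -((1 + A q) / 4) := fun q hq => by rw [hA q hq]; ring
  have ddτ : ∀ q ∈ W, dz (dz τ) q = 0 := fun q hq => by
    have := (((holτ.dz hW).hasPD hW hq).congr (ev (fun x hx => show -((1 + A x) / 4) = dz τ x from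
      (dτ x hx).symm) q hq)).dz_eq
    rw [← this, (((HasPD.const (-1 / 4) q).mul ((HasPD.const 1 q).add
      (holA.hasPD hW hq))).congr (Eventually.of_forall fun x => by ring)).dz_eq, dA q hq]
    ring
  -- Differentiating `τ_u = n'τ - nτ'` in `ζ` leaves `n''τ - nτ'' = 0`, hence `(τ')_u = 0`.
  have dAu : ∀ q ∈ W, du A q = 0 := fun q hq => by
    have h1 := (((holτ.du hW).hasPD hW hq).congr (ev (fun x hx => (hτu x hx).symm) q hq)).dz_eq
    rw [(((holν.hasPD hW hq).mul (holτ.hasPD hW hq)).sub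
      ((holn.hasPD hW hq).mul ((holτ.dz hW).hasPD hW hq))).dz_eq, holτ.dz_du hW hq, dν q hq,
      ddτ q hq] at h1
    have h4 : du (dz τ) q = 0 := by rw [← h1]; ring
    have h5 := (holA.hasPD hW hq).unique ((((HasPD.const (-1) q).sub ((HasPD.const 4 q).mul
      ((holτ.dz hW).hasPD hW hq)))).congr (ev hA q hq))
    rw [h5.2, h4]; ring
  obtain ⟨q₁, hq₁⟩ := hc.nonempty
  have hconst : ∀ q ∈ W, A q = A q₁ := fun q hq => by
    refine eq_of_hasFDerivAt_zero hW hc.isPreconnected (fun x hx => ?_) hq hq₁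
    refine HasFDerivAt.congr_fderiv (holA.hasPD hW hx) ?_
    rw [dA x hx, dAu x hx]
    refine ContinuousLinearMap.ext fun v => by simp
  refine ⟨A q₁, hconst, hW, hc.isPreconnected, hF, hφ, holτ, fun _ _ => rfl, h2, ?_, hA1 q₁ hq₁,
    ?_, ?_, ?_⟩
  · intro q hq
    rw [hτ q hq]
    exact div_ne_zero (h2 q hq) (h3 q hq)
  · intro q hq
    rw [← hconst q hq]; exact hν q hq
  · intro q hq
    have := h3 q hq
    have := h2 q hq
    refine (hφ.hasPD hW hq).cast ?_ ?_
    · rw [hτ q hq]; field_simp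
    · rw [hτ q hq, hn q hq]; field_simp
  · intro q hq
    refine (holτ.hasPD hW hq).cast ?_ ?_
    · rw [dτ q hq, hconst q hq]
    · rw [hτu q hq, dτ q hq, hconst q hq]; ring

/-! ### Normal forms: integration of the profile and the exponential case `A = -1`. -/

namespace ProfileData

variable {f : ℂ → ℝ → ℂ} {φ τ n ν : ℂ × ℝ → ℂ} {A : ℂ} {U : Set Pt}

/-- If `ψ` is a local second primitive of `φ`, then `f - ψ` is affine in `ζ`. -/
lemma exists_eq_add {F ψ a b c : ℂ × ℝ → ℂ} {W : Set (ℂ × ℝ)} (hd : ProfileData F φ τ n ν A W)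
    {z₀ : ℂ} {r : ℝ} {J : Set ℝ} (hr : 0 < r) (hJ : IsOpen J) (hN : Metric.ball z₀ r ×ˢ J ⊆ W)
    (hψ : HolOn ψ (Metric.ball z₀ r ×ˢ J))
    (h1 : ∀ q ∈ Metric.ball z₀ r ×ˢ J, HasPD ψ (a q) (b q) q)
    (h2 : ∀ q ∈ Metric.ball z₀ r ×ˢ J, HasPD a (φ q) (c q) q) :
    ∃ g c : ℝ → ℂ, ContDiffOn ℝ ∞ g J ∧ ContDiffOn ℝ ∞ c J ∧
      ∀ q ∈ Metric.ball z₀ r ×ˢ J, F q = ψ q + g q.2 * q.1 + c q.2 := by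
  have hNo := Metric.isOpen_ball.prod hJ (s := Metric.ball z₀ r)
  have hFN := hd.holF.mono hN
  obtain ⟨g, c, hg, hc, h⟩ := exists_affine hr hJ (hFN.sub hψ hNo) (fun q hq => by
    rw [dz_dz_eq (φ := fun q => φ q - φ q) (a := fun q => dz F q - a q) hNo
      (fun x hx => (hFN.hasPD hNo hx).sub (h1 x hx))
      (fun x hx => (((hFN.dz hNo).hasPD hNo hx).sub (h2 x hx)).cast
        (by rw [hd.dzF x (hN hx)]) rfl) hq, sub_self])
  refine ⟨g, c, hg, hc, fun q hq => ?_⟩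
  rw [add_assoc, ← h q hq]; ring

/-- Dividing by the value at `q₀` moves that value to `1`, so the principal logarithm of the
quotient plus `log Φ(q₀)` is a smooth branch of `log Φ` near `q₀`, wherever `Φ(q₀)` lies. -/
lemma tendsto_slit {W : Set (ℂ × ℝ)} {Φ : ℂ × ℝ → ℂ} (hW : IsOpen W) (h : HolOn Φ W)
    {q₀ : ℂ × ℝ} (hq : q₀ ∈ W) (h0 : Φ q₀ ≠ 0) : ∀ᶠ q in 𝓝 q₀, Φ q / Φ q₀ ∈ slitPlane := by
  have hc : ContinuousAt (fun q => Φ q / Φ q₀) q₀ :=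
    (h.contDiffAt hW hq).continuousAt.div_const _
  refine hc.eventually_mem (isOpen_slitPlane.mem_nhds ?_)
  simp [div_self h0]

/-- For `A = -1` the function `τ` depends on `u` only locally, so `φ' = φ/τ` makes `φ` exponential
in `ζ` and `φτ²` a second primitive. As `τ_u = ντ` with `ν` imaginary, `|τ|` is constant and gives
`k = 1/|τ|`; the phase of `1/τ` becomes `h`. -/
theorem hasFormNear_formE (hd : ProfileData (fun q => f q.1 q.2) φ τ n ν A (zu '' U))
    (hA : A = -1) (hne : U.Nonempty) :
    ∃ k : ℝ, 0 < k ∧ ∀ p ∈ U, HasFormNear (FormE k) f U (zu p) := by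
  obtain ⟨p₁, hp₁⟩ := hne
  set W := zu '' U with hWdef
  have hW := hd.isOpen
  have hq₁ : zu p₁ ∈ W := ⟨p₁, hp₁, rfl⟩
  have pdτ : ∀ q ∈ W, HasPD τ 0 (ν q * τ q) q := fun q hq =>
    (hd.pdτ q hq).cast (by rw [hA]; ring) (by rw [hA]; ring)
  have hnorm : ∀ q ∈ W, ‖τ q‖ = ‖τ (zu p₁)‖ := fun q hq => by
    have := eq_of_hasFDerivAt_zero hW hd.isPreconnected (fun x hx =>
      (pdτ x hx).hasFDerivAt_mul_conj (pdτ x hx) (by simp) (by simp) (by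
        have h1 := hd.ν_eq x hx
        rw [hA] at h1
        rw [map_mul]
        linear_combination (τ x * conj (τ x)) * h1)) hq hq₁
    simp only [mul_conj, normSq_eq_norm_sq] at this
    exact (sq_eq_sq₀ (norm_nonneg _) (norm_nonneg _)).1 (by exact_mod_cast this)
  refine ⟨‖τ (zu p₁)‖⁻¹, by simpa using hd.τ_ne _ hq₁, fun p hp => ?_⟩
  have hq₀ : zu p ∈ W := ⟨p, hp, rfl⟩
  rw [← hnorm _ hq₀]
  generalize zu p = q₀ at hq₀ ⊢
  set ψ : ℂ × ℝ → ℂ := fun q => φ q * τ q ^ 2 with hψdef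
  have hψ0 : ∀ q ∈ W, ψ q ≠ 0 := fun q hq =>
    mul_ne_zero (hd.φ_ne q hq) (pow_ne_zero 2 (hd.τ_ne q hq))
  have holψ : HolOn ψ W := (hd.holφ.mul (hd.holτ.mul hd.holτ hW) hW).congr hW fun q _ => by
    simp only [hψdef]; ring
  have pd1 : ∀ q ∈ W, HasPD ψ (φ q * τ q) (du ψ q) q := fun q hq => by
    have h0 := hd.τ_ne q hq
    have h1 := ((hd.pdφ q hq).mul ((pdτ q hq).mul (pdτ q hq))).congr
      (Ψ := ψ) (Eventually.of_forall fun x => by simp only [hψdef]; ring)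
    exact h1.cast (by field_simp; ring) h1.du_eq.symm
  have pd2 : ∀ q ∈ W, HasPD (fun q => φ q * τ q) (φ q)
      (du (fun q => φ q * τ q) q) q := fun q hq => by
    have h0 := hd.τ_ne q hq
    have h1 := (hd.pdφ q hq).mul (pdτ q hq)
    exact h1.cast (by field_simp; ring) h1.du_eq.symm
  obtain ⟨r, hr, hbox⟩ := exists_box ((hW.eventually_mem hq₀).and
    ((tendsto_slit hW holψ hq₀ (hψ0 _ hq₀)).and (tendsto_slit hW hd.holτ hq₀ (hd.τ_ne _ hq₀))))
  set J := Set.Ioo (q₀.2 - r) (q₀.2 + r) with hJ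
  have hJo : IsOpen J := isOpen_Ioo
  set N := Metric.ball q₀.1 r ×ˢ J with hNdef
  have hNo : IsOpen N := Metric.isOpen_ball.prod hJo
  have hN : N ⊆ W := fun q hq => (hbox q hq).1
  set Λ : ℂ × ℝ → ℂ := fun q => Complex.log (ψ q / ψ q₀) + Complex.log (ψ q₀) with hΛ
  have expΛ : ∀ q ∈ N, Complex.exp (Λ q) = ψ q := fun q hq => by
    rw [hΛ, Complex.exp_add, Complex.exp_log (slitPlane_ne_zero (hbox q hq).2.1),
      Complex.exp_log (hψ0 _ hq₀), div_mul_cancel₀ _ (hψ0 _ hq₀)]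
  have holψN := (holψ.mono hN).div (HolOn.const (ψ q₀) N) hNo fun _ _ => hψ0 _ hq₀
  have holΛ : HolOn Λ N :=
    (holψN.log hNo fun q hq => (hbox q hq).2.1).add (HolOn.const _ N) hNo
  have dzΛ : ∀ q ∈ N, dz Λ q = 1 / τ q := fun q hq => by
    have h0 := hd.τ_ne q (hN hq)
    have h1 := hd.φ_ne q (hN hq)
    have h2 := ((((pd1 q (hN hq)).div (HasPD.const (ψ q₀) q) (hψ0 _ hq₀)).log (hbox q hq).2.1).add
      (HasPD.const (Complex.log (ψ q₀)) q)).dz_eq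
    have h3 := hψ0 q₀ hq₀
    have h4 : ψ q = φ q * τ q ^ 2 := rfl
    rw [h2, h4, mul_zero, sub_zero, add_zero]
    field_simp
  have holτN := hd.holτ.mono hN
  -- The shift is defined by `(ζ + s)/τ = Λ`, a logarithm of `φτ²`.
  obtain ⟨s, hs, hs'⟩ := exists_of_dz_eq_zero hr hJo
    ((holΛ.mul holτN hNo).sub (HolOn.fst N) hNo) (fun q hq => by
      have h0 := hd.τ_ne q (hN hq)
      rw [(((holΛ.hasPD hNo hq).mul (pdτ q (hN hq))).sub (HasPD.fst q)).dz_eq, dzΛ q hq]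
      field_simp; ring)
  -- The unimodular quotient `t = τ/τ(q₀)` stays in the slit plane, so its argument is a smooth
  -- function of `u`.
  obtain ⟨t, ht, ht'⟩ := exists_of_dz_eq_zero hr hJo
    (holτN.div (HolOn.const (τ q₀) N) hNo fun _ _ => hd.τ_ne _ hq₀) (fun q hq => by
      rw [((pdτ q (hN hq)).div (HasPD.const (τ q₀) q) (hd.τ_ne _ hq₀)).dz_eq]; simp)
  have hmem : ∀ u ∈ J, (q₀.1, u) ∈ N := fun u hu => ⟨Metric.mem_ball_self hr, hu⟩
  have htslit : ∀ u ∈ J, t u ∈ slitPlane := fun u hu => by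
    rw [← ht' _ (hmem u hu)]; exact (hbox _ (hmem u hu)).2.2
  have htnorm : ∀ u ∈ J, ‖t u‖ = 1 := fun u hu => by
    rw [← ht' _ (hmem u hu), norm_div, hnorm _ (hN (hmem u hu)), hnorm _ hq₀, div_self]
    simpa using hd.τ_ne _ hq₁
  have hlog : ContDiffOn ℝ ∞ (fun u => Complex.log (t u)) J := fun u hu =>
    (contDiffAt_log (htslit u hu)).restrict_scalars ℝ |>.comp_contDiffWithinAt u (ht u hu)
  set h : ℝ → ℝ := fun u => (τ q₀)⁻¹.arg - (Complex.log (t u)).im with hh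
  have hhs : ContDiffOn ℝ ∞ h J := contDiffOn_const.sub (imCLM.contDiff.comp_contDiffOn hlog)
  have hexp : ∀ q ∈ N, ((‖τ q₀‖⁻¹ : ℝ) : ℂ) * Complex.exp (I * (h q.2 : ℂ)) = 1 / τ q := by
    intro q hq
    have h1 : ((‖τ q₀‖⁻¹ : ℝ) : ℂ) * Complex.exp ((τ q₀)⁻¹.arg * I) = (τ q₀)⁻¹ := by
      rw [← norm_inv]; exact norm_mul_exp_arg_mul_I _
    have h2 : Complex.exp (((Complex.log (t q.2)).im : ℂ) * I) = t q.2 := by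
      have := norm_mul_exp_arg_mul_I (t q.2)
      rwa [htnorm _ hq.2, ofReal_one, one_mul, ← Complex.log_im] at this
    have h3 := ht' q hq
    have h4 := hd.τ_ne _ (hN hq)
    have h5 := hd.τ_ne _ hq₀
    rw [hh, ofReal_sub, mul_sub, Complex.exp_sub, mul_comm I, mul_comm I, h2, ← mul_div_assoc, h1,
      ← h3]
    field_simp
  obtain ⟨g, c, hg, hc, hf⟩ := hd.exists_eq_add hr hJo hN (holψ.mono hN)
    (fun q hq => pd1 q (hN hq)) (fun q hq => pd2 q (hN hq))
  refine hasFormNear_of_eq_add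
    (F := fun z u => Complex.exp (((‖τ q₀‖⁻¹ : ℝ) : ℂ) * Complex.exp (I * (h u : ℂ)) * z))
    hr hJ hN hs hg hc (fun q hq => ?_) (fun g hg => ⟨h, g, hhs, hg, fun q _ => rfl⟩)
  rw [hf q hq, hexp q hq, ← hs' q hq, ← expΛ q hq]
  have h4 := hd.τ_ne _ (hN hq)
  congr 4
  field_simp
  ring

end ProfileData

/-! ### The logarithmic case `A = 1`. -/

namespace ProfileData

variable {f : ℂ → ℝ → ℂ} {φ τ n ν : ℂ × ℝ → ℂ} {A : ℂ} {U : Set Pt}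

/-- The translated coordinate `Z = -τ/β = ζ + s(u)` in the case `β = (1 + A)/4 ≠ 0`. -/
lemma hasPD_Z {β : ℂ} {W : Set (ℂ × ℝ)} {F : ℂ × ℝ → ℂ} (hd : ProfileData F φ τ n ν A W)
    (hβ : β = (1 + A) / 4) (hβ0 : β ≠ 0) {q : ℂ × ℝ} (hq : q ∈ W) :
    HasPD (fun q => -τ q / β) 1 (ν q * (-τ q / β) - n q) q := by
  have h := ((HasPD.const (-1 / β) q).mul (hd.pdτ q hq)).congr (Ψ := fun q => -τ q / β)
    (Eventually.of_forall fun x => by ring)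
  refine h.cast ?_ ?_
  · rw [← hβ]; field_simp; ring
  · rw [← hβ]; field_simp; ring

lemma holOn_Z {β : ℂ} {W : Set (ℂ × ℝ)} {F : ℂ × ℝ → ℂ} (hd : ProfileData F φ τ n ν A W)
    (hβ : β = (1 + A) / 4) (hβ0 : β ≠ 0) : HolOn (fun q => -τ q / β) W :=
  HolOn.of_hasPD (by
    simp only [div_eq_mul_inv]
    exact hd.holτ.smooth.neg.mul contDiffOn_const) fun q hq => hd.hasPD_Z hβ hβ0 hq

/-- For `A = 1` the slope of `τ` is `-1/2`, so `Z = -2τ = ζ + s(u)` locally and `T = φτ²` does not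
depend on `ζ`. Hence `φ` is `4T/Z²`, with second primitive `-4T log Z`. Since `T_u = 2νT` with `ν`
real, the phase of `T` is constant. -/
theorem hasFormNear_formL (hd : ProfileData (fun q => f q.1 q.2) φ τ n ν A (zu '' U))
    (hA : A = 1) (hne : U.Nonempty) :
    ∃ k : ℝ, ∀ p ∈ U, HasFormNear (FormL k) f U (zu p) := by
  obtain ⟨p₁, hp₁⟩ := hne
  set W := zu '' U with hWdef
  have hW := hd.isOpen
  have hq₁ : zu p₁ ∈ W := ⟨p₁, hp₁, rfl⟩
  have hβ : (1 / 2 : ℂ) = (1 + A) / 4 := by rw [hA]; norm_num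
  have hβ0 : (1 / 2 : ℂ) ≠ 0 := by norm_num
  set Z : ℂ × ℝ → ℂ := fun q => -τ q / (1 / 2) with hZdef
  have hZ : ∀ q, Z q = -2 * τ q := fun q => by simp only [hZdef]; ring
  have pdZ : ∀ q ∈ W, HasPD Z 1 (ν q * Z q - n q) q := fun q hq => hd.hasPD_Z hβ hβ0 hq
  have holZ : HolOn Z W := hd.holOn_Z hβ hβ0
  have hZ0 : ∀ q ∈ W, Z q ≠ 0 := fun q hq => by
    rw [hZ]; exact mul_ne_zero (by norm_num) (hd.τ_ne q hq)
  set T : ℂ × ℝ → ℂ := fun q => φ q * τ q ^ 2 with hTdef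
  have hT0 : ∀ q ∈ W, T q ≠ 0 := fun q hq =>
    mul_ne_zero (hd.φ_ne q hq) (pow_ne_zero 2 (hd.τ_ne q hq))
  have holT : HolOn T W := (hd.holφ.mul (hd.holτ.mul hd.holτ hW) hW).congr hW fun q _ => by
    simp only [hTdef]; ring
  have pdT : ∀ q ∈ W, HasPD T 0 (2 * ν q * T q) q := fun q hq => by
    have h0 := hd.τ_ne q hq
    have h1 := ((hd.pdφ q hq).mul ((hd.pdτ q hq).mul (hd.pdτ q hq))).congr
      (Ψ := T) (Eventually.of_forall fun x => by simp only [hTdef]; ring)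
    refine h1.cast ?_ ?_
    · rw [← hβ]; field_simp; ring
    · rw [← hβ]; simp only [hTdef]; field_simp; ring
  -- `T/T̄` is the square of the phase of `T`; this fixes the phase up to sign, which is enough
  -- because `h` may have either sign.
  have hquot : ∀ q ∈ W, T q * conj (T q)⁻¹ = T (zu p₁) * conj (T (zu p₁))⁻¹ := fun q hq =>
    eq_of_hasFDerivAt_zero (Φ := fun q => T q * conj (T q)⁻¹) hW hd.isPreconnected (fun x hx => by
      have h0 := hT0 x hx
      have h1 : conj (T x) ≠ 0 := by simpa using h0
      refine (pdT x hx).hasFDerivAt_mul_conj ((pdT x hx).inv h0) (by simp) (by simp) ?_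
      have h2 := hd.ν_eq x hx
      rw [hA, one_mul] at h2
      simp only [map_inv₀, map_div₀, map_neg, map_mul, map_pow, Complex.conj_ofNat, ← h2]
      field_simp
      ring) hq hq₁
  set k : ℝ := (T (zu p₁)).arg with hk
  set E : ℂ := Complex.exp (I * (k : ℂ)) with hE
  have hE0 : E ≠ 0 := Complex.exp_ne_zero _
  have hconjE : conj E = E⁻¹ := by
    rw [hE, ← Complex.exp_conj, ← Complex.exp_neg]
    simp
  have hTreal : ∀ q ∈ W, conj (T q / E) = T q / E := fun q hq => by
    have h1 := hquot q hq
    have h2 : T (zu p₁) = ‖T (zu p₁)‖ * E := by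
      rw [hE, mul_comm I]; exact (norm_mul_exp_arg_mul_I _).symm
    have h3 : (‖T (zu p₁)‖ : ℂ) ≠ 0 := by simpa using hT0 _ hq₁
    have h4 : T (zu p₁) * conj (T (zu p₁))⁻¹ = E ^ 2 := by
      rw [h2, map_inv₀, map_mul, conj_ofReal, hconjE]
      field_simp
    have h5 : conj (T q) ≠ 0 := by simpa using hT0 q hq
    rw [h4, map_inv₀] at h1
    field_simp at h1
    rw [map_div₀, hconjE, div_inv_eq_mul, eq_div_iff hE0]
    linear_combination -h1
  refine ⟨k, fun p hp => ?_⟩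
  have hq₀ : zu p ∈ W := ⟨p, hp, rfl⟩
  generalize zu p = q₀ at hq₀ ⊢
  obtain ⟨r, hr, hbox⟩ := exists_box ((hW.eventually_mem hq₀).and
    (tendsto_slit hW holZ hq₀ (hZ0 _ hq₀)))
  set J := Set.Ioo (q₀.2 - r) (q₀.2 + r) with hJ
  have hJo : IsOpen J := isOpen_Ioo
  set N := Metric.ball q₀.1 r ×ˢ J with hNdef
  have hNo : IsOpen N := Metric.isOpen_ball.prod hJo
  have hN : N ⊆ W := fun q hq => (hbox q hq).1
  have hmem : ∀ u ∈ J, (q₀.1, u) ∈ N := fun u hu => ⟨Metric.mem_ball_self hr, hu⟩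
  obtain ⟨s, hs, hs'⟩ := exists_of_dz_eq_zero hr hJo
    ((holZ.mono hN).sub (HolOn.fst N) hNo) (fun q hq => by
      rw [((pdZ q (hN hq)).sub (HasPD.fst q)).dz_eq, sub_self])
  have hsZ : ∀ q ∈ N, q.1 + s q.2 = Z q := fun q hq => by rw [← hs' q hq]; ring
  obtain ⟨t, ht, ht'⟩ := exists_of_dz_eq_zero hr hJo (holT.mono hN)
    (fun q hq => (pdT q (hN hq)).dz_eq)
  set l : ℂ → ℂ := fun z => Complex.log (z / Z q₀) + Complex.log (Z q₀) with hl
  -- Chosen so that `e^{ik} h = -4T`, the coefficient of the logarithm; `T/e^{ik}` is real by the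
  -- constancy of the phase.
  set h : ℝ → ℝ := fun u => -4 * (t u / E).re with hh
  have hhs : ContDiffOn ℝ ∞ h J := by
    refine contDiffOn_const.mul (reCLM.contDiff.comp_contDiffOn (f := fun u => t u / E) ?_)
    simp only [div_eq_mul_inv]
    exact ht.mul contDiffOn_const
  have hhE : ∀ q ∈ N, E * (h q.2 : ℂ) = -4 * T q := fun q hq => by
    have h1 := hTreal q (hN hq)
    rw [conj_eq_iff_re] at h1
    simp only [hh]
    rw [← ht' q hq]
    push_cast
    rw [h1]
    field_simp
  have pdl : ∀ q ∈ N, HasPD (fun q => l (Z q)) (1 / Z q) ((ν q * Z q - n q) / Z q) q :=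
    fun q hq => by
      have h0 := hZ0 q (hN hq)
      have h1 := hZ0 _ hq₀
      exact ((((pdZ q (hN hq)).div (HasPD.const (Z q₀) q) h1).log (hbox q hq).2).add
        (HasPD.const _ q)).cast (by field_simp; ring) (by field_simp; ring)
  have pd1 : ∀ q ∈ N, HasPD (fun q => -4 * T q * l (Z q)) (2 * (φ q * τ q))
      (du (fun q => -4 * T q * l (Z q)) q) q := fun q hq => by
    have h1 := ((HasPD.const (-4) q).mul (pdT q (hN hq))).mul (pdl q hq)
    have h2 := hd.τ_ne q (hN hq)
    refine h1.cast ?_ h1.du_eq.symm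
    rw [hZ]; simp only [hTdef]; field_simp; ring
  have pd2 : ∀ q ∈ N, HasPD (fun q => 2 * (φ q * τ q)) (φ q)
      (du (fun q => 2 * (φ q * τ q)) q) q := fun q hq => by
    have h0 := hd.τ_ne q (hN hq)
    have h1 := (HasPD.const 2 q).mul ((hd.pdφ q (hN hq)).mul (hd.pdτ q (hN hq)))
    refine h1.cast ?_ h1.du_eq.symm
    rw [← hβ]; field_simp; ring
  have hollZ : HolOn (fun q => l (Z q)) N :=
    ((((holZ.mono hN).div (HolOn.const (Z q₀) N) hNo fun _ _ => hZ0 _ hq₀).log hNo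
      fun q hq => (hbox q hq).2).add (HolOn.const _ N) hNo)
  obtain ⟨g, c, hg, hc, hf⟩ := hd.exists_eq_add hr hJo hN
    (((HolOn.const (-4) N).mul (holT.mono hN) hNo).mul hollZ hNo) pd1 pd2
  refine hasFormNear_of_eq_add (F := fun z u => E * (h u : ℂ) * l z)
    hr hJ hN hs hg hc (fun q hq => ?_) (fun g hg => ⟨h, g, fun q => l q.1, hhs, hg, ?_, ?_, ?_, ?_⟩)
  · rw [hf q hq, hsZ q hq, hhE q hq]
  · intro u hu h0
    have h1 := hhE _ (hmem u hu)
    simp only [h0, ofReal_zero, mul_zero] at h1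
    exact mul_ne_zero (by norm_num) (hT0 _ (hN (hmem u hu))) h1.symm
  · rintro _ ⟨q, hq, rfl⟩
    refine ContinuousAt.continuousWithinAt ?_
    have hcl : ContinuousAt l (q.1 + s q.2) := by
      have : (q.1 + s q.2) / Z q₀ ∈ slitPlane := by rw [hsZ q hq]; exact (hbox q hq).2
      exact ((continuousAt_id.div_const _).clog this).add continuousAt_const
    exact ContinuousAt.comp (f := Prod.fst) (x := (q.1 + s q.2, q.2)) hcl continuousAt_fst
  · rintro _ ⟨q, hq, rfl⟩
    simp only [hsZ q hq]
    rw [hl, Complex.exp_add, Complex.exp_log (slitPlane_ne_zero (hbox q hq).2),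
      Complex.exp_log (hZ0 _ hq₀), div_mul_cancel₀ _ (hZ0 _ hq₀)]
  · exact fun q _ => rfl

end ProfileData

/-! ### The power case `A² ≠ 1`. -/

namespace ProfileData

variable {f : ℂ → ℝ → ℂ} {φ τ n ν : ℂ × ℝ → ℂ} {A : ℂ} {U : Set Pt}

/-- If `ψ'/ψ = κ/Z` with `κ` imaginary, the phase of `ψ Z^{-κ}` is constant. -/
lemma phase_const {ψ Z n ν : ℂ × ℝ → ℂ} {W : Set (ℂ × ℝ)} {κ : ℂ} (hW : IsOpen W)
    (hc : IsPreconnected W) (hκ : conj κ = -κ)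
    (hψ0 : ∀ q ∈ W, ψ q ≠ 0) (hZ0 : ∀ q ∈ W, Z q ≠ 0)
    (pdψ : ∀ q ∈ W, HasPD ψ (ψ q * (κ / Z q)) (ψ q * (2 * ν q - n q * (κ / Z q))) q)
    (pdZ : ∀ q ∈ W, HasPD Z 1 (ν q * Z q - n q) q)
    (hν : ∀ q ∈ W, (2 - κ) * ν q = conj ((2 - κ) * ν q)) {p q : ℂ × ℝ} (hp : p ∈ W) (hq : q ∈ W) :
    ψ p / ‖ψ p‖ * Complex.exp (-κ * Real.log ‖Z p‖) =
      ψ q / ‖ψ q‖ * Complex.exp (-κ * Real.log ‖Z q‖) := by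
  set E : ℂ × ℝ → ℂ := fun q => ψ q / ‖ψ q‖ * Complex.exp (-κ * Real.log ‖Z q‖) with hE
  have hE0 : ∀ q ∈ W, E q ≠ 0 := fun q hq =>
    mul_ne_zero (div_ne_zero (hψ0 q hq) (by simpa using hψ0 q hq)) (Complex.exp_ne_zero _)
  have hslit : ∀ q ∈ W, Z q * conj (Z q) ∈ slitPlane := fun q hq => by
    rw [mul_conj, ofReal_mem_slitPlane]
    exact normSq_pos.2 (hZ0 q hq)
  -- The square of `E` replaces the norm of `ψ` by `ψ ψ̄` and `2 log |Z|` by `log (Z Z̄)`, which can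
  -- be differentiated through holomorphic and antiholomorphic factors.
  set E2 : ℂ × ℝ → ℂ := fun q => ψ q * conj (ψ q)⁻¹ *
    Complex.exp (-κ * Complex.log (Z q * conj (Z q))) with hE2
  have hsq : ∀ q ∈ W, E q ^ 2 = E2 q := fun q hq => by
    have h1 : Complex.log (Z q * conj (Z q)) = 2 * (Real.log ‖Z q‖ : ℂ) := by
      rw [mul_conj, normSq_eq_norm_sq, ← ofReal_log (by positivity), Real.log_pow]
      push_cast; ring
    have h2 : (‖ψ q‖ : ℂ) ^ 2 = ψ q * conj (ψ q) := by
      rw [mul_conj, normSq_eq_norm_sq]; push_cast; ring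
    have h3 : conj (ψ q) ≠ 0 := by simpa using hψ0 q hq
    have h4 := hψ0 q hq
    simp only [hE, hE2]
    rw [h1, mul_pow, div_pow, h2, ← Complex.exp_nat_mul, map_inv₀]
    congr 1
    · field_simp
    · congr 1; push_cast; ring
  have hd : ∀ q ∈ W, HasFDerivAt E2 (0 : ℂ × ℝ →L[ℝ] ℂ) q := fun q hq => by
    have h0 := hψ0 q hq
    have h0' : conj (ψ q) ≠ 0 := by simpa using h0
    have h1 := hZ0 q hq
    have h1' : conj (Z q) ≠ 0 := by simpa using h1
    have d1 := HasFDerivAt.mul (pdψ q hq) (HasPD.hasFDerivAt_conj ((pdψ q hq).inv h0))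
    have d0 : HasFDerivAt (fun q => Z q * conj (Z q)) _ q :=
      HasFDerivAt.mul (pdZ q hq) (HasPD.hasFDerivAt_conj (pdZ q hq))
    have d1' := ((hasDerivAt_log (hslit q hq)).hasFDerivAt.restrictScalars ℝ).comp q d0
    have d2 := (d1'.const_mul (-κ)).cexp
    refine (HasFDerivAt.mul d1 d2).congr_fderiv ?_
    refine ContinuousLinearMap.ext fun v => ?_
    have h2 := hν q hq
    simp only [map_mul, map_sub, Complex.conj_ofNat, hκ] at h2
    simp [hκ, Complex.conj_ofNat]
    field_simp
    linear_combination ψ q * Complex.exp (-(κ * Complex.log (Z q * conj (Z q)))) *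
      (v.2 : ℂ) * Z q * conj (Z q) * h2
  have hcE : ContinuousOn E W := by
    have cψ : ContinuousOn ψ W := fun q hq =>
      (HasFDerivAt.continuousAt (pdψ q hq)).continuousWithinAt
    have cZ : ContinuousOn Z W := fun q hq =>
      (HasFDerivAt.continuousAt (pdZ q hq)).continuousWithinAt
    refine (cψ.div (continuous_ofReal.comp_continuousOn cψ.norm) fun q hq => ?_).mul
      (Continuous.comp_continuousOn Complex.continuous_exp (continuousOn_const.mul
        (continuous_ofReal.comp_continuousOn (cZ.norm.log fun q hq => ?_))))
    · simpa using hψ0 q hq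
    · simpa using hZ0 q hq
  -- A continuous function with constant nonzero square on a connected set is constant.
  have := hc.eq_or_eq_neg_of_sq_eq (f := E) (g := fun _ => E q) hcE continuousOn_const
    (fun x hx => by
      change E x ^ 2 = E q ^ 2
      rw [hsq x hx, hsq q hq, eq_of_hasFDerivAt_zero hW hc hd hx hq]) (fun _ => hE0 q hq)
  rcases this with h | h
  · exact h hp
  · have h1 := h hq
    simp only [Pi.neg_apply] at h1
    exact absurd (self_eq_neg.1 h1) (hE0 q hq)

/-- With `β = (1 + A)/4` and `Z = -τ/β`, locally `ζ + s(u)`, the equation `φ'/φ = -1/(βZ)` makes `φ`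
a multiple of `Z^{-1/β}`, whose second primitive is a multiple of `Z^κ`, `κ = 2 - 1/β = 2(A - 1)/(A
+ 1)`. Unimodularity of `A` makes `κ = 2ik₁` imaginary, and `A ≠ 1` makes it nonzero. Then `Z^κ`
changes by a positive factor under a change of branch, so the phase of `ψ Z^{-κ}` is a global
constant, encoded in `k₀`, while its modulus is encoded in `h`. -/
theorem hasFormNear_formP (hd : ProfileData (fun q => f q.1 q.2) φ τ n ν A (zu '' U))
    (hA : A ≠ 1) (hA' : A ≠ -1) (hne : U.Nonempty) :
    ∃ k₀ k₁ : ℝ, 0 < k₀ ∧ k₁ ≠ 0 ∧ ∀ p ∈ U, HasFormNear (FormP k₀ k₁) f U (zu p) := by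
  obtain ⟨p₁, hp₁⟩ := hne
  set W := zu '' U with hWdef
  have hW := hd.isOpen
  have hq₁ : zu p₁ ∈ W := ⟨p₁, hp₁, rfl⟩
  have h1A : 1 + A ≠ 0 := fun h => hA' (by linear_combination h)
  set β : ℂ := (1 + A) / 4 with hβ
  have hβ0 : β ≠ 0 := div_ne_zero h1A (by norm_num)
  have hβ1 : 1 - 2 * β ≠ 0 := fun h => hA (by rw [hβ] at h; linear_combination -2 * h)
  have hnA : ‖A‖ = 1 := by
    have h1 := hd.norm_A
    rw [mul_conj, normSq_eq_norm_sq] at h1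
    have h2 : ‖A‖ ^ 2 = 1 := by exact_mod_cast h1
    nlinarith [norm_nonneg A]
  have hβ2 : 1 - β ≠ 0 := fun h => by
    have h3 : A = 3 := by rw [hβ] at h; linear_combination -4 * h
    rw [h3] at hnA; norm_num at hnA
  set κ : ℂ := 2 - 1 / β with hκdef
  have hA0 : A ≠ 0 := fun h => by simp [h] at hnA
  have hconjA : conj A = A⁻¹ := eq_inv_of_mul_eq_one_right hd.norm_A
  have hκ : conj κ = -κ := by
    have h1 : 1 + A⁻¹ ≠ 0 := fun h => h1A (by field_simp at h; linear_combination h)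
    have h2 : A + 1 ≠ 0 := by rwa [add_comm]
    simp only [hκdef, hβ, map_sub, map_div₀, map_one, map_add, Complex.conj_ofNat, hconjA]
    field_simp
    ring
  set k₁ : ℝ := κ.im / 2 with hk₁
  have hκk : κ = 2 * I * (k₁ : ℂ) := by
    have hre : κ.re = 0 := by
      have := congrArg re hκ
      simp at this
      linarith
    apply Complex.ext <;> simp [hre, hk₁]
    ring
  have hκ0 : κ ≠ 0 := fun h => hβ1 (by rw [hκdef] at h; field_simp at h; linear_combination -h)
  have hk0 : k₁ ≠ 0 := fun h => hκ0 (by rw [hκk, h]; simp)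
  set Z : ℂ × ℝ → ℂ := fun q => -τ q / β with hZdef
  have pdZ : ∀ q ∈ W, HasPD Z 1 (ν q * Z q - n q) q := fun q hq => hd.hasPD_Z hβ hβ0 hq
  have holZ : HolOn Z W := hd.holOn_Z hβ hβ0
  have hZ0 : ∀ q ∈ W, Z q ≠ 0 := fun q hq =>
    div_ne_zero (neg_ne_zero.2 (hd.τ_ne q hq)) hβ0
  -- Two integrations of the power divide by `κ(κ - 1) = (1 - 2β)(1 - β)/β²`; the `β²` is absorbed
  -- by `τ² = β²Z²`.
  set c₁ : ℂ := 1 / ((1 - 2 * β) * (1 - β)) with hc₁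
  have hc₁0 : c₁ ≠ 0 := one_div_ne_zero (mul_ne_zero hβ1 hβ2)
  set ψ : ℂ × ℝ → ℂ := fun q => c₁ * (φ q * (τ q * τ q)) with hψdef
  have hψ0 : ∀ q ∈ W, ψ q ≠ 0 := fun q hq =>
    mul_ne_zero hc₁0 (mul_ne_zero (hd.φ_ne q hq) (mul_ne_zero (hd.τ_ne q hq) (hd.τ_ne q hq)))
  have holψ : HolOn ψ W :=
    (HolOn.const c₁ W).mul (hd.holφ.mul (hd.holτ.mul hd.holτ hW) hW) hW
  have pdψ : ∀ q ∈ W, HasPD ψ (ψ q * (κ / Z q)) (ψ q * (2 * ν q - n q * (κ / Z q))) q :=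
    fun q hq => by
      have h0 := hd.τ_ne q hq
      have h1 := (HasPD.const c₁ q).mul ((hd.pdφ q hq).mul ((hd.pdτ q hq).mul (hd.pdτ q hq)))
      refine h1.cast ?_ ?_
      · simp only [← hβ, hψdef, hZdef, hκdef]; field_simp; ring
      · simp only [← hβ, hψdef, hZdef, hκdef]; field_simp; ring
  have pd2 : ∀ q ∈ W, HasPD (fun q => ψ q * (κ / Z q)) (φ q)
      (du (fun q => ψ q * (κ / Z q)) q) q := fun q hq => by
    have h0 := hd.τ_ne q hq
    have h1 := hZ0 q hq
    have h2 := (pdψ q hq).mul ((HasPD.const κ q).div (pdZ q hq) h1)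
    refine h2.cast ?_ h2.du_eq.symm
    simp only [hψdef, hZdef, hκdef, hc₁]
    field_simp
    ring
  have hphase : ∀ {p q : ℂ × ℝ}, p ∈ W → q ∈ W →
      ψ p / ‖ψ p‖ * Complex.exp (-κ * Real.log ‖Z p‖) =
        ψ q / ‖ψ q‖ * Complex.exp (-κ * Real.log ‖Z q‖) := fun hp hq =>
    phase_const hW hd.isPreconnected hκ hψ0 hZ0 pdψ pdZ (fun q hq => by
      have h1 := hd.ν_eq q hq
      -- The relation `ν = A ν̄` with `|A| = 1` says that `ν/(1 + A)` is real.
      have h3 : 2 - κ = 4 / (1 + A) := by rw [hκdef, hβ]; field_simp; ring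
      have h4 : 1 + A⁻¹ = (1 + A) / A := by field_simp; ring
      rw [h3, map_mul, map_div₀, map_add, hconjA, map_one, Complex.conj_ofNat, h4]
      generalize conj (ν q) = w at h1 ⊢
      rw [h1]
      field_simp) hp hq
  set E : ℂ := ψ (zu p₁) / ‖ψ (zu p₁)‖ * Complex.exp (-κ * Real.log ‖Z (zu p₁)‖) with hE
  have hEn : ‖E‖ = 1 := by
    rw [hE, norm_mul, norm_div, norm_real, norm_norm, div_self (by simpa using hψ0 _ hq₁), one_mul,
      Complex.norm_exp, hκk]
    simp
  have hEarg : Complex.exp ((E.arg : ℂ) * I) = E := by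
    have := norm_mul_exp_arg_mul_I E
    rwa [hEn, ofReal_one, one_mul] at this
  -- Chosen so that `k₀ = e^m` satisfies `k₀^{2ik₁} = E`, the constant phase.
  set m : ℝ := E.arg / (2 * k₁) with hm
  refine ⟨Real.exp m, k₁, Real.exp_pos _, hk0, fun p hp => ?_⟩
  have hq₀ : zu p ∈ W := ⟨p, hp, rfl⟩
  generalize zu p = q₀ at hq₀ ⊢
  obtain ⟨r, hr, hbox⟩ := exists_box ((hW.eventually_mem hq₀).and
    (tendsto_slit hW holZ hq₀ (hZ0 _ hq₀)))
  set J := Set.Ioo (q₀.2 - r) (q₀.2 + r) with hJ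
  have hJo : IsOpen J := isOpen_Ioo
  set N := Metric.ball q₀.1 r ×ˢ J with hNdef
  have hNo : IsOpen N := Metric.isOpen_ball.prod hJo
  have hN : N ⊆ W := fun q hq => (hbox q hq).1
  have hmem : ∀ u ∈ J, (q₀.1, u) ∈ N := fun u hu => ⟨Metric.mem_ball_self hr, hu⟩
  obtain ⟨s, hs, hs'⟩ := exists_of_dz_eq_zero hr hJo
    ((holZ.mono hN).sub (HolOn.fst N) hNo) (fun q hq => by
      rw [((pdZ q (hN hq)).sub (HasPD.fst q)).dz_eq, sub_self])
  have hsZ : ∀ q ∈ N, q.1 + s q.2 = Z q := fun q hq => by rw [← hs' q hq]; ring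
  set l : ℂ → ℂ := fun z => Complex.log (z / Z q₀) + Complex.log (Z q₀) with hl
  have expl : ∀ q ∈ N, Complex.exp (l (Z q)) = Z q := fun q hq => by
    rw [hl, Complex.exp_add, Complex.exp_log (slitPlane_ne_zero (hbox q hq).2),
      Complex.exp_log (hZ0 _ hq₀), div_mul_cancel₀ _ (hZ0 _ hq₀)]
  have pdl : ∀ q ∈ N, HasPD (fun q => l (Z q)) (1 / Z q) ((ν q * Z q - n q) / Z q) q :=
    fun q hq => by
      have h0 := hZ0 q (hN hq)
      have h1 := hZ0 _ hq₀
      exact ((((pdZ q (hN hq)).div (HasPD.const (Z q₀) q) h1).log (hbox q hq).2).add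
        (HasPD.const _ q)).cast (by field_simp; ring) (by field_simp; ring)
  have hollZ : HolOn (fun q => l (Z q)) N :=
    ((((holZ.mono hN).div (HolOn.const (Z q₀) N) hNo fun _ _ => hZ0 _ hq₀).log hNo
      fun q hq => (hbox q hq).2).add (HolOn.const _ N) hNo)
  -- `R = ψ (k₀Z)^{-κ}` depends on `u` only. The phase has been removed, so it is positive and
  -- equals `e^{-2k₁h}` for a real `h`.
  set R : ℂ × ℝ → ℂ := fun q => ψ q * Complex.exp (-κ * (m + l (Z q))) with hR
  have holR : HolOn R N := (holψ.mono hN).mul (((HolOn.const (-κ) N).mul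
    ((HolOn.const (m : ℂ) N).add hollZ hNo) hNo).exp hNo) hNo
  obtain ⟨ρ, hρ, hρ'⟩ := exists_of_dz_eq_zero hr hJo holR (fun q hq => by
    rw [((pdψ q (hN hq)).mul (((HasPD.const (-κ) q).mul ((HasPD.const (m : ℂ) q).add
      (pdl q hq))).exp)).dz_eq]
    ring)
  have hRpos : ∀ q ∈ N, R q = (‖ψ q‖ * Real.exp (2 * k₁ * (l (Z q)).im) : ℝ) := fun q hq => by
    have h1 : (l (Z q)).re = Real.log ‖Z q‖ := by
      conv_rhs => rw [← expl q hq, Complex.norm_exp, Real.log_exp]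
    have h2 := hphase (hN hq) hq₁
    rw [← hE, ← hEarg] at h2
    have h3 : (‖ψ q‖ : ℂ) ≠ 0 := by simpa using hψ0 q (hN hq)
    have h4 : ψ q = ‖ψ q‖ * Complex.exp ((E.arg : ℂ) * I) *
        Complex.exp (κ * Real.log ‖Z q‖) := by
      rw [← h2, neg_mul, Complex.exp_neg]
      have := Complex.exp_ne_zero (κ * Real.log ‖Z q‖)
      field_simp
    have h5 : (m : ℂ) * (2 * k₁) = E.arg := by
      rw [hm]; push_cast
      have : (k₁ : ℂ) ≠ 0 := by exact_mod_cast hk0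
      field_simp
    simp only [hR]
    conv_lhs => rw [h4, ← re_add_im (l (Z q)), h1]
    push_cast
    rw [mul_assoc, mul_assoc, ← Complex.exp_add, ← Complex.exp_add, ← h5, hκk]
    congr 2
    linear_combination (-2 * k₁ * ((l (Z q)).im : ℂ)) * I_sq
  have hρpos : ∀ u ∈ J, 0 < (ρ u).re := fun u hu => by
    have h1 := hRpos _ (hmem u hu)
    rw [hρ' _ (hmem u hu)] at h1
    simp only at h1
    rw [h1, ofReal_re]
    have := hψ0 _ (hN (hmem u hu))
    positivity
  set h : ℝ → ℝ := fun u => -Real.log (ρ u).re / (2 * k₁) with hh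
  have hhs : ContDiffOn ℝ ∞ h J := by
    simp only [hh, div_eq_mul_inv]
    exact (((reCLM.contDiff.comp_contDiffOn hρ).log fun u hu => (hρpos u hu).ne').neg).mul
      contDiffOn_const
  have hψexp : ∀ q ∈ N, ψ q =
      Complex.exp (2 * I * (k₁ : ℂ) * (m + I * (h q.2 : ℂ) + l (Z q))) := fun q hq => by
    have h1 : Complex.exp (-2 * k₁ * (h q.2 : ℂ)) = R q := by
      have h2 : ((ρ q.2).re : ℂ) = R q := by
        have := hRpos q hq
        rw [← hρ' q hq, this, ofReal_re]
      rw [← h2, ← Real.exp_log (hρpos q.2 hq.2)]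
      push_cast
      congr 1
      simp only [hh]
      have : (k₁ : ℂ) ≠ 0 := by exact_mod_cast hk0
      push_cast
      field_simp
    have h3 : 2 * I * (k₁ : ℂ) * (m + I * (h q.2 : ℂ) + l (Z q)) =
        -2 * k₁ * (h q.2 : ℂ) + κ * (m + l (Z q)) := by
      rw [hκk]; linear_combination (2 * k₁ * (h q.2 : ℂ)) * I_sq
    rw [h3, Complex.exp_add, h1, hR, mul_assoc, ← Complex.exp_add]
    simp
  obtain ⟨g, c, hg, hc, hf⟩ := hd.exists_eq_add hr hJo hN (holψ.mono hN)
    (fun q hq => pdψ q (hN hq)) (fun q hq => pd2 q (hN hq))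
  refine hasFormNear_of_eq_add
    (F := fun z u => Complex.exp (2 * I * (k₁ : ℂ) * (m + I * (h u : ℂ) + l z)))
    hr hJ hN hs hg hc (fun q hq => ?_)
    (fun g hg => ⟨h, g, fun q => m + I * (h q.2 : ℂ) + l q.1, hhs, hg, ?_, ?_, fun q _ => rfl⟩)
  · rw [hf q hq, hsZ q hq, hψexp q hq]
  · rintro _ ⟨q, hq, rfl⟩
    have hcl : ContinuousAt l (q.1 + s q.2) := by
      have : (q.1 + s q.2) / Z q₀ ∈ slitPlane := by rw [hsZ q hq]; exact (hbox q hq).2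
      exact ((continuousAt_id.div_const _).clog this).add continuousAt_const
    have hch : ContinuousAt h q.2 := hhs.continuousOn.continuousAt (hJo.mem_nhds hq.2)
    have h1 : ContinuousAt (fun x : ℂ × ℝ => l x.1) (q.1 + s q.2, q.2) :=
      ContinuousAt.comp (f := Prod.fst) (x := (q.1 + s q.2, q.2)) hcl continuousAt_fst
    have h2 : ContinuousAt (fun x : ℂ × ℝ => h x.2) (q.1 + s q.2, q.2) :=
      ContinuousAt.comp (f := Prod.snd) (x := (q.1 + s q.2, q.2)) hch continuousAt_snd
    exact ((continuousAt_const.add (continuousAt_const.mul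
      (continuous_ofReal.continuousAt.comp h2))).add h1).continuousWithinAt
  · rintro _ ⟨q, hq, rfl⟩
    simp only [hsZ q hq]
    rw [Complex.exp_add, Complex.exp_add, expl q hq, ofReal_exp]

end ProfileData

/-! ### The geometry of the metric -/

/-- `zu` as a continuous linear map. -/
def zuL : Pt →L[ℝ] ℂ × ℝ :=
  (equivRealProdCLM.symm.toContinuousLinearMap ∘L
    ((ContinuousLinearMap.proj 0).prod (ContinuousLinearMap.proj 1))).prod
    (ContinuousLinearMap.proj 2)

lemma zuL_apply (p : Pt) : zuL p = zu p := by
  refine Prod.ext (Complex.ext ?_ ?_) ?_ <;> simp [zuL, zu, zeta]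

lemma zuL_single (i : Fin 4) :
    zuL (Pi.single i 1) = (![(1, 0), (I, 0), (0, 1), (0, 0)] : Fin 4 → ℂ × ℝ) i := by
  rw [zuL_apply]
  fin_cases i <;> refine Prod.ext (Complex.ext ?_ ?_) ?_ <;> simp [zu, zeta]

lemma isOpen_zu_image {U : Set Pt} (hU : IsOpen U) : IsOpen (zu '' U) := by
  have hs : Function.Surjective zuL := fun q =>
    ⟨![q.1.re, q.1.im, q.2, 0], by rw [zuL_apply]; simp [zu, zeta]⟩
  have := zuL.isOpenMap hs U hU
  rwa [show (zuL : Pt → ℂ × ℝ) = zu from funext zuL_apply] at this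

lemma continuous_zu : Continuous zu := by
  rw [← show (zuL : Pt → ℂ × ℝ) = zu from funext zuL_apply]
  exact zuL.continuous

lemma HasPD.hasFDerivAt_zu {Φ : ℂ × ℝ → ℂ} {a b : ℂ} {p : Pt} (h : HasPD Φ a b (zu p)) :
    HasFDerivAt (fun q => Φ (zu q)) (pdMap a b ∘L zuL) p := by
  have h1 : HasFDerivAt zu zuL p := by
    rw [← show (zuL : Pt → ℂ × ℝ) = zu from funext zuL_apply]; exact zuL.hasFDerivAt
  exact HasFDerivAt.comp p h h1

lemma HasPD.pd_zu {Φ : ℂ × ℝ → ℂ} {a b : ℂ} {p : Pt} (h : HasPD Φ a b (zu p)) (i : Fin 4) :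
    pd i (fun q => Φ (zu q)) p = ![a, a * I, b, 0] i := by
  rw [pd, h.hasFDerivAt_zu.fderiv, ContinuousLinearMap.comp_apply, zuL_single]
  fin_cases i <;> simp

lemma HasPD.pd_re_zu {Φ : ℂ × ℝ → ℂ} {a b : ℂ} {p : Pt} (h : HasPD Φ a b (zu p)) (i : Fin 4) :
    pd i (fun q => (Φ (zu q)).re) p = ![a.re, -a.im, b.re, 0] i := by
  have h1 : HasFDerivAt (fun q => (Φ (zu q)).re) (reCLM ∘L (pdMap a b ∘L zuL)) p :=
    reCLM.hasFDerivAt.comp p h.hasFDerivAt_zu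
  rw [pd, h1.fderiv, ContinuousLinearMap.comp_apply, ContinuousLinearMap.comp_apply, zuL_single]
  fin_cases i <;> simp

lemma pd_congr {E : Type*} [NormedAddCommGroup E] [NormedSpace ℝ E] {F K : Pt → E} {p : Pt}
    (h : F =ᶠ[𝓝 p] K) (i : Fin 4) : pd i F p = pd i K p := by
  rw [pd, pd, h.fderiv_eq]

lemma pd_conj (i : Fin 4) (F : Pt → ℂ) (p : Pt) :
    pd i (fun q => conj (F q)) p = conj (pd i F p) := by
  have := conjCLE.comp_fderiv (f := F) (x := p)
  change fderiv ℝ (conjCLE ∘ F) p _ = _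
  rw [this]
  rfl

lemma IsVacuumPPWave.holOn {f : ℂ → ℝ → ℂ} {U : Set Pt} (hf : IsVacuumPPWave f U) (hU : IsOpen U) :
    HolOn (fun q => f q.1 q.2) (zu '' U) := by
  refine ⟨hf.smooth, fun q hq => ?_⟩
  have hd : HasFDerivAt (fun q : ℂ × ℝ => f q.1 q.2) _ q :=
    ((hf.smooth.contDiffAt ((isOpen_zu_image hU).mem_nhds hq)).differentiableAt
      (by simp)).hasFDerivAt
  have h1 : HasFDerivAt (fun z => f z q.2) _ q.1 :=
    HasFDerivAt.comp (f := fun e => (e, q.2)) (g := fun q : ℂ × ℝ => f q.1 q.2) q.1 hd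
      (hasFDerivAt_prodMk_left q.1 q.2)
  have h2 := h1.unique ((hf.holo q hq).hasDerivAt.hasFDerivAt.restrictScalars ℝ)
  have e1 := DFunLike.congr_fun h2 1
  have e2 := DFunLike.congr_fun h2 I
  simp at e1 e2
  rw [e1, e2]

lemma metric_inv (f : ℂ → ℝ → ℂ) (p : Pt) :
    (metric f p)⁻¹ = !![1 / 2, 0, 0, 0; 0, 1 / 2, 0, 0; 0, 0, 0, -1;
      0, 0, -1, 2 * (f (zeta p) (p 2)).re] := by
  refine Matrix.inv_eq_right_inv ?_
  ext i j
  fin_cases i <;> fin_cases j <;> simp [metric, Matrix.mul_apply, Fin.sum_univ_four]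

/-- The Christoffel symbols in terms of the derivatives `K` of `Re f`. -/
def gam (K : Fin 4 → ℝ) (k i j : Fin 4) : ℝ :=
  (![(!![0, 0, 0, 0; 0, 0, 0, 0; 0, 0, K 0 / 2, 0; 0, 0, 0, 0] : Matrix _ _ ℝ) i j,
    (!![0, 0, 0, 0; 0, 0, 0, 0; 0, 0, K 1 / 2, 0; 0, 0, 0, 0] : Matrix _ _ ℝ) i j, 0,
    (!![0, 0, K 0, 0; 0, 0, K 1, 0; K 0, K 1, K 2, 0; 0, 0, 0, 0] : Matrix _ _ ℝ) i j] :
      Fin 4 → ℝ) k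

lemma gam_eq_zero (K : Fin 4 → ℝ) {k i j : Fin 4} (hi : i ≠ 2) (hj : j ≠ 2) : gam K k i j = 0 := by
  fin_cases k <;> fin_cases i <;> fin_cases j <;>
    first | exact absurd rfl hi | exact absurd rfl hj | simp [gam]

lemma gam_three_right (K : Fin 4 → ℝ) (k i : Fin 4) : gam K k i 3 = 0 := by
  fin_cases k <;> fin_cases i <;> simp [gam]

lemma gam_eq_zero_of_ne (K : Fin 4 → ℝ) {k i j : Fin 4} (hk : k ≠ 3) (hj : j ≠ 2) :
    gam K k i j = 0 := by
  fin_cases k <;> fin_cases i <;> fin_cases j <;>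
    first | exact absurd rfl hk | exact absurd rfl hj | simp [gam]

lemma gam_three_two {K : Fin 4 → ℝ} (hK : K 3 = 0) (j : Fin 4) : gam K 3 2 j = K j := by
  fin_cases j <;> simp [gam, hK]

/-- The derivatives of `Re f`. -/
def reGrad (f : ℂ → ℝ → ℂ) (p : Pt) : Fin 4 → ℝ :=
  ![(dz (fun q => f q.1 q.2) (zu p)).re, -(dz (fun q => f q.1 q.2) (zu p)).im,
    (du (fun q => f q.1 q.2) (zu p)).re, 0]

section

variable {f : ℂ → ℝ → ℂ} {U : Set Pt}

lemma pd_metric (hU : IsOpen U) (hf : IsVacuumPPWave f U) {p : Pt} (hp : p ∈ U) (m i j : Fin 4) :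
    pd m (fun q => metric f q i j) p =
      (!![0, 0, 0, 0; 0, 0, 0, 0; 0, 0, -2 * reGrad f p m, 0; 0, 0, 0, 0] :
        Matrix (Fin 4) (Fin 4) ℝ) i j := by
  have hpd := (hf.holOn hU).hasPD (isOpen_zu_image hU) (q := zu p) ⟨p, hp, rfl⟩
  have h := HasPD.pd_re_zu ((HasPD.const (-2) _).mul hpd) m
  simp only [zero_mul, zero_add] at h
  have h22 : pd m (fun q => metric f q 2 2) p = -2 * reGrad f p m := by
    have : (fun q => metric f q 2 2) = fun q : Pt => ((-2 : ℂ) * f (zu q).1 (zu q).2).re := by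
      funext q; simp [metric, zu]
    rw [this, h]
    fin_cases m <;> simp [reGrad]
  have hconst : ∀ c : ℝ, pd m (fun _ : Pt => c) p = 0 := fun c => by simp [pd]
  fin_cases i <;> fin_cases j <;> first | exact h22 | exact hconst _

lemma christoffel_metric (hU : IsOpen U) (hf : IsVacuumPPWave f U) {p : Pt} (hp : p ∈ U)
    (k i j : Fin 4) : christoffel (metric f) k i j p = gam (reGrad f p) k i j := by
  simp only [christoffel, pd_metric hU hf hp, metric_inv, Fin.sum_univ_four]
  have h3 : reGrad f p 3 = 0 := by simp [reGrad]
  fin_cases k <;> fin_cases i <;> fin_cases j <;> simp [gam, h3] <;> ring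

lemma pd_reGrad (hU : IsOpen U) (hf : IsVacuumPPWave f U) {p : Pt} (hp : p ∈ U) (m : Fin 4) :
    pd m (fun q => reGrad f q 0) p = ![(dz (dz fun q => f q.1 q.2) (zu p)).re,
      -(dz (dz fun q => f q.1 q.2) (zu p)).im, (du (dz fun q => f q.1 q.2) (zu p)).re, 0] m ∧
    pd m (fun q => reGrad f q 1) p = ![-(dz (dz fun q => f q.1 q.2) (zu p)).im,
      -(dz (dz fun q => f q.1 q.2) (zu p)).re, -(du (dz fun q => f q.1 q.2) (zu p)).im, 0] m := by
  have hW := isOpen_zu_image hU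
  have hpd := ((hf.holOn hU).dz hW).hasPD hW (q := zu p) ⟨p, hp, rfl⟩
  have h0 := HasPD.pd_re_zu hpd m
  have h1 := HasPD.pd_re_zu ((HasPD.const I _).mul hpd) m
  simp only [zero_mul, zero_add] at h1
  constructor
  · exact h0
  · have : (fun q => reGrad f q 1) = fun q : Pt => (I * dz (fun q => f q.1 q.2) (zu q)).re := by
      funext q; simp [reGrad]
    rw [this, h1]
    fin_cases m <;> simp

/-- The quadratic terms vanish because one factor has no lower index `u`, and the summed index of
the other is `v` below or differs from `v` above. What remains is the Hessian of `Re f`. Components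
with `b` or `d` equal to `u` are not needed, since `δ*` has no `u`-component. -/
lemma riemannUp_metric (hU : IsOpen U) (hf : IsVacuumPPWave f U) {p : Pt} (hp : p ∈ U)
    (a b c d : Fin 4) (hb : b ≠ 2) (hd : d ≠ 2) : riemannUp (metric f) a b c d p =
      if a = 3 ∧ c = 2 then -pd d (fun q => reGrad f q b) p else 0 := by
  have ev : ∀ k i j, christoffel (metric f) k i j =ᶠ[𝓝 p] fun q => gam (reGrad f q) k i j :=
    fun k i j => by
      filter_upwards [hU.mem_nhds hp] with q hq using christoffel_metric hU hf hq k i j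
  have hconst : ∀ m, pd m (fun _ : Pt => (0 : ℝ)) p = 0 := fun m => by simp [pd]
  have hq : ∀ K : Fin 4 → ℝ,
      ∑ m, (gam K a c m * gam K m d b - gam K a d m * gam K m c b) = 0 := fun K => by
    refine Finset.sum_eq_zero fun m _ => ?_
    rw [gam_eq_zero K hd hb, mul_zero, zero_sub, neg_eq_zero]
    by_cases hm : m = 3
    · rw [hm, gam_three_right, zero_mul]
    · rw [gam_eq_zero_of_ne K hm hb, mul_zero]
  simp only [riemannUp, christoffel_metric hU hf hp, hq, add_zero]
  rw [pd_congr (ev a d b), pd_congr (ev a c b)]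
  simp only [gam_eq_zero _ hd hb, hconst, zero_sub]
  by_cases ha : a = 3
  · by_cases hc : c = 2
    · subst ha hc
      have h3 : ∀ q, reGrad f q 3 = 0 := fun q => by simp [reGrad]
      simp only [gam_three_two (h3 _), and_self, if_true]
    · simp only [gam_eq_zero _ hc hb, hconst, neg_zero, hc, and_false, if_false]
  · simp only [gam_eq_zero_of_ne _ ha hb, hconst, neg_zero, ha, false_and, if_false]

lemma riemann_metric (hU : IsOpen U) (hf : IsVacuumPPWave f U) {p : Pt} (hp : p ∈ U)
    (a b c d : Fin 4) (hb : b ≠ 2) (hd : d ≠ 2) : riemann (metric f) a b c d p =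
      if a = 2 ∧ c = 2 then pd d (fun q => reGrad f q b) p else 0 := by
  simp only [riemann, riemannUp_metric hU hf hp _ b c d hb hd, Fin.sum_univ_four]
  by_cases hc : c = 2
  · fin_cases a <;> simp [metric, hc]
  · simp [hc]

/-- Modulo `∂_v`, `Y` is `2 Y⁰ ∂_ζ`, and the Hessian of `Re f` on `(∂_ζ, ∂_ζ)` is `f''/2`. -/
lemma curv_metric (hU : IsOpen U) (hf : IsVacuumPPWave f U) {p : Pt} (hp : p ∈ U)
    {X Y : VF} (h2 : Y p 2 = 0) (h1 : Y p 1 = -I * Y p 0) :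
    curv (metric f) X Y X Y p =
      2 * X p 2 ^ 2 * Y p 0 ^ 2 * dz (dz fun q => f q.1 q.2) (zu p) := by
  have key : ∀ a b c d, (riemann (metric f) a b c d p : ℂ) * X p a * Y p b * X p c * Y p d =
      if a = 2 ∧ c = 2 then ((pd d (fun q => reGrad f q b) p : ℝ) : ℂ) * X p 2 * Y p b * X p 2 * Y p d
      else 0 := by
    intro a b c d
    by_cases hb : b = 2
    · simp [hb, h2]
    by_cases hd : d = 2
    · simp [hd, h2]
    rw [riemann_metric hU hf hp a b c d hb hd]
    split_ifs with h
    · rw [h.1, h.2]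
    · simp
  have h3 : ∀ m, pd m (fun q => reGrad f q 3) p = 0 := fun m => by simp [reGrad, pd]
  have hpd := fun m => pd_reGrad hU hf hp m
  simp only [curv, key]
  simp [Fin.sum_univ_four, h2, h3, hpd, h1]
  conv_rhs => rw [← re_add_im (dz (dz fun q => f q.1 q.2) (zu p))]
  ring_nf
  simp only [I_sq]
  ring

lemma ip_metric (f : ℂ → ℝ → ℂ) (X Y : VF) (p : Pt) :
    ip (metric f) X Y p = 2 * X p 0 * Y p 0 + 2 * X p 1 * Y p 1 -
      2 * (f (zeta p) (p 2)).re * X p 2 * Y p 2 - X p 2 * Y p 3 - X p 3 * Y p 2 := by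
  simp [ip, metric, Fin.sum_univ_four]
  ring

lemma cov_metric (hU : IsOpen U) (hf : IsVacuumPPWave f U) {p : Pt} (hp : p ∈ U) (X Y : VF) :
    cov (metric f) X Y p 0 = along X (fun q => Y q 0) p + reGrad f p 0 / 2 * X p 2 * Y p 2 ∧
    cov (metric f) X Y p 1 = along X (fun q => Y q 1) p + reGrad f p 1 / 2 * X p 2 * Y p 2 ∧
    cov (metric f) X Y p 2 = along X (fun q => Y q 2) p := by
  simp only [cov, along, christoffel_metric hU hf hp, Fin.sum_univ_four]
  refine ⟨?_, ?_, ?_⟩ <;> simp [gam] <;> ring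

end

/-! ### Derivatives along complexified vector fields -/

section

variable {X : VF} {F K : Pt → ℂ} {p : Pt}

lemma along_congr (h : F =ᶠ[𝓝 p] K) (X : VF) : along X F p = along X K p := by
  simp only [along, pd_congr h]

lemma along_const (X : VF) (c : ℂ) (p : Pt) : along X (fun _ => c) p = 0 := by
  simp [along, pd]

lemma along_mul (hF : DifferentiableAt ℝ F p) (hK : DifferentiableAt ℝ K p) (X : VF) :
    along X (fun q => F q * K q) p = along X F p * K p + F p * along X K p := by
  simp only [along, pd, fderiv_fun_mul hF hK, Fin.sum_univ_four]
  simp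
  ring

lemma along_add (hF : DifferentiableAt ℝ F p) (hK : DifferentiableAt ℝ K p) (X : VF) :
    along X (fun q => F q + K q) p = along X F p + along X K p := by
  simp only [along, pd, fderiv_fun_add hF hK, Fin.sum_univ_four]
  simp
  ring

lemma along_conj (X : VF) (F : Pt → ℂ) (p : Pt) :
    along X (fun q => conj (F q)) p = conj (along (cvf X) F p) := by
  simp [along, pd_conj, cvf]

lemma along_zu {Φ : ℂ × ℝ → ℂ} {a b : ℂ} (h : HasPD Φ a b (zu p)) (X : VF) :
    along X (fun q => Φ (zu q)) p = a * (X p 0 + I * X p 1) + b * X p 2 := by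
  simp only [along, h.pd_zu, Fin.sum_univ_four]
  simp
  ring

/-- This is the two-form `dF ∧ dK` evaluated on `(X, Y)`. -/
lemma along_eq_of_wedge {U : Set Pt} (h : WedgeZeroOn F K U) (hp : p ∈ U) (X Y : VF) :
    along X F p * along Y K p = along Y F p * along X K p := by
  have := h p hp
  have key : ∀ i j, X p i * pd i F p * (Y p j * pd j K p) =
      Y p j * pd j F p * (X p i * pd i K p) := fun i j => by
    linear_combination X p i * Y p j * this i j
  simp only [along, Finset.sum_mul_sum, key]
  rw [Finset.sum_comm]

lemma along_congr_left {Y : VF} (h : X p = Y p) (F : Pt → ℂ) : along X F p = along Y F p := by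
  simp only [along, h]

end

/-! ### Normalized tetrads -/

lemma differentiableAt_comp {U : Set Pt} (hU : IsOpen U) {X : VF} (hX : ContDiffOn ℝ ∞ X U) {p : Pt}
    (hp : p ∈ U) (i : Fin 4) : DifferentiableAt ℝ (fun q => X q i) p :=
  differentiableAt_pi.1 ((hX.contDiffAt (hU.mem_nhds hp)).differentiableAt (by simp)) i

lemma _root_.DifferentiableAt.conj_comp {F : Pt → ℂ} {p : Pt} (h : DifferentiableAt ℝ F p) :
    DifferentiableAt ℝ (fun q => conj (F q)) p :=
  conjCLE.differentiableAt.comp p h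

/-- The second derivative `∂²f/∂ζ²`, as a function of `(ζ, u)`. -/
def profile (f : ℂ → ℝ → ℂ) : ℂ × ℝ → ℂ := dz (dz fun q => f q.1 q.2)

/-- The quotient `φ / φ'` for `φ = ∂²f/∂ζ²`. -/
def profileTau (f : ℂ → ℝ → ℂ) (q : ℂ × ℝ) : ℂ := profile f q / dz (profile f) q

/-- The quotient `-φ_u / φ'` for `φ = ∂²f/∂ζ²`. -/
def profileN (f : ℂ → ℝ → ℂ) (q : ℂ × ℝ) : ℂ := -du (profile f) q / dz (profile f) q

namespace Tetrad

variable {f : ℂ → ℝ → ℂ} {U : Set Pt} {e : Tetrad}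

lemma deltaBar_apply (e : Tetrad) (p : Pt) (i : Fin 4) : e.deltaBar p i = conj (e.delta p i) := rfl

lemma delta_zero (e : Tetrad) (p : Pt) : e.delta p 0 = conj (e.deltaBar p 0) := by
  rw [deltaBar_apply, conj_conj]

lemma cvf_deltaBar (e : Tetrad) : cvf e.deltaBar = e.delta := by
  funext p i; simp [deltaBar, cvf]

namespace IsNormalized

/-- The components of a null tetrad aligned with `∂_v`. -/
lemma components (he : e.IsNormalized f U) {p : Pt} (hp : p ∈ U) :
    e.Delta p 2 * e.D p 3 = 1 ∧ e.delta p 2 = 0 ∧ e.delta p 1 ^ 2 = (I * e.delta p 0) ^ 2 ∧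
      2 * e.delta p 0 * conj (e.delta p 0) + 2 * e.delta p 1 * conj (e.delta p 1) = 1 := by
  obtain ⟨d0, d1, d2⟩ := he.aligned p hp
  have h1 := he.Delta_D p hp
  have h2 := he.delta_D p hp
  have h3 := he.delta_delta p hp
  have h4 := he.delta_deltaBar p hp
  simp only [ip_metric, d0, d1, d2, deltaBar_apply, mul_zero, add_zero, sub_zero, zero_sub,
    neg_inj] at h1 h2 h3 h4
  have h5 : e.delta p 2 = 0 := by
    have : e.D p 3 ≠ 0 := fun h => by simp [h] at h1
    exact (mul_eq_zero.1 (neg_eq_zero.1 h2)).resolve_right this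
  simp only [h5, map_zero, mul_zero, zero_mul, sub_zero] at h3 h4
  refine ⟨h1, h5, ?_, h4⟩
  rw [mul_pow, I_sq]
  linear_combination h3 / 2

lemma conj_Delta (he : e.IsNormalized f U) {p : Pt} (hp : p ∈ U) (i : Fin 4) :
    conj (e.Delta p i) = e.Delta p i := congrFun (he.real_Delta p hp) i

end IsNormalized

/-- A normalized tetrad with `δ*` proportional to `∂_ζ` modulo `∂_v`. -/
structure IsOriented (e : Tetrad) (f : ℂ → ℝ → ℂ) (U : Set Pt) : Prop where
  isOpen : IsOpen U
  wave : IsVacuumPPWave f U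
  normalized : e.IsNormalized f U
  orient : ∀ p ∈ U, e.delta p 1 = I * e.delta p 0

/-! ### Spin coefficients of an oriented tetrad and the derivatives of `α`. -/

namespace IsOriented

variable (he : e.IsOriented f U) {p : Pt}
include he

lemma deltaBar_two (hp : p ∈ U) : e.deltaBar p 2 = 0 := by
  rw [deltaBar_apply, (he.normalized.components hp).2.1, map_zero]

lemma deltaBar_one (hp : p ∈ U) : e.deltaBar p 1 = -I * e.deltaBar p 0 := by
  rw [deltaBar_apply, deltaBar_apply, he.orient p hp]; simp

lemma four_mul (hp : p ∈ U) : 4 * e.deltaBar p 0 * conj (e.deltaBar p 0) = 1 := by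
  have h := (he.normalized.components hp).2.2.2
  rw [he.orient p hp, delta_zero, map_mul, conj_I] at h
  simp only [conj_conj] at h
  linear_combination h + 2 * conj (e.deltaBar p 0) * e.deltaBar p 0 * I_sq

lemma deltaBar_ne_zero (hp : p ∈ U) : e.deltaBar p 0 ≠ 0 := fun h => by
  simpa [h] using he.four_mul hp

lemma Delta_ne_zero (hp : p ∈ U) : e.Delta p 2 ≠ 0 := fun h => by
  simpa [h] using (he.normalized.components hp).1

lemma eventually {P : Pt → Prop} (h : ∀ p ∈ U, P p) (hp : p ∈ U) : ∀ᶠ q in 𝓝 p, P q := by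
  filter_upwards [he.isOpen.mem_nhds hp] with q hq using h q hq

lemma psi_eq (hp : p ∈ U) :
    2 * e.Delta p 2 ^ 2 * e.deltaBar p 0 ^ 2 * profile f (zu p) = 1 := by
  rw [← he.normalized.psi4 p hp, Psi4, curv_metric he.isOpen he.wave hp (he.deltaBar_two hp)
    (he.deltaBar_one hp)]
  rfl

lemma profile_ne_zero (hp : p ∈ U) : profile f (zu p) ≠ 0 := fun h => by
  simpa [h] using he.psi_eq hp

lemma holOn_profile : HolOn (profile f) (zu '' U) :=
  ((he.wave.holOn he.isOpen).dz (isOpen_zu_image he.isOpen)).dz (isOpen_zu_image he.isOpen)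

lemma hasPD {Φ : ℂ × ℝ → ℂ} (h : HolOn Φ (zu '' U)) (hp : p ∈ U) :
    HasPD Φ (dz Φ (zu p)) (du Φ (zu p)) (zu p) :=
  h.hasPD (isOpen_zu_image he.isOpen) ⟨p, hp, rfl⟩

lemma differentiableAt_zu {Φ : ℂ × ℝ → ℂ} (h : HolOn Φ (zu '' U)) (hp : p ∈ U) :
    DifferentiableAt ℝ (fun q => Φ (zu q)) p :=
  (he.hasPD h hp).hasFDerivAt_zu.differentiableAt

lemma along_deltaBar {Φ : ℂ × ℝ → ℂ} (h : HolOn Φ (zu '' U)) (hp : p ∈ U) :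
    along e.deltaBar (fun q => Φ (zu q)) p = 2 * e.deltaBar p 0 * dz Φ (zu p) := by
  rw [along_zu (he.hasPD h hp), he.deltaBar_two hp, he.deltaBar_one hp]
  linear_combination (-dz Φ (zu p) * e.deltaBar p 0) * I_sq

lemma along_delta {Φ : ℂ × ℝ → ℂ} (h : HolOn Φ (zu '' U)) (hp : p ∈ U) :
    along e.delta (fun q => Φ (zu q)) p = 0 := by
  rw [along_zu (he.hasPD h hp), (he.normalized.components hp).2.1, he.orient p hp]
  linear_combination (dz Φ (zu p) * e.delta p 0) * I_sq

lemma differentiableAt_deltaBar (hp : p ∈ U) (i : Fin 4) :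
    DifferentiableAt ℝ (fun q => e.deltaBar q i) p :=
  (differentiableAt_comp he.isOpen he.normalized.smooth_delta hp i).conj_comp

lemma differentiableAt_Delta (hp : p ∈ U) (i : Fin 4) :
    DifferentiableAt ℝ (fun q => e.Delta q i) p :=
  differentiableAt_comp he.isOpen he.normalized.smooth_Delta hp i

/-- The connection component that gives both `α` and `γ`. -/
lemma connection_eq (hp : p ∈ U) (X : VF) :
    1 / 2 * (ip (metric f) e.D (cov (metric f) X e.Delta) p -
      ip (metric f) e.delta (cov (metric f) X e.deltaBar) p) =
    along X (fun q => profile f (zu q)) p /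
      (4 * profile f (zu p)) := by
  obtain ⟨d0, d1, d2⟩ := he.normalized.aligned p hp
  obtain ⟨c0, c1, c2⟩ := cov_metric he.isOpen he.wave hp X e.deltaBar
  obtain ⟨-, -, c2'⟩ := cov_metric he.isOpen he.wave hp X e.Delta
  have hB := he.deltaBar_ne_zero hp
  have ha := he.Delta_ne_zero hp
  have hΦ := he.profile_ne_zero hp
  have dB := he.differentiableAt_deltaBar hp 0
  have da := he.differentiableAt_Delta hp 2
  have dΦ := he.differentiableAt_zu he.holOn_profile hp
  have e2 : along X (fun q => e.deltaBar q 2) p = 0 := by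
    rw [along_congr (he.eventually (fun q hq => he.deltaBar_two hq) hp) X, along_const]
  have e1 : along X (fun q => e.deltaBar q 1) p = -I * along X (fun q => e.deltaBar q 0) p := by
    rw [along_congr (he.eventually (fun q hq => he.deltaBar_one hq) hp) X,
      along_mul (differentiableAt_const _) dB, along_const]
    ring
  -- Logarithmic differentiation of `2a²B²φ = 1` along `X` turns `-(Xa/a + XB/B)/2`, which is the
  -- connection component, into `Xφ/(4φ)`.
  have hψ := along_congr (he.eventually (fun q hq => show (2 * ((e.Delta q 2 * e.Delta q 2) *
      ((e.deltaBar q 0 * e.deltaBar q 0) * profile f (zu q)))) = 1 by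
    rw [← he.psi_eq hq]; ring) hp) X
  rw [along_mul (differentiableAt_const _) ((da.fun_mul da).fun_mul ((dB.fun_mul dB).fun_mul dΦ)),
    along_mul (da.fun_mul da) ((dB.fun_mul dB).fun_mul dΦ), along_mul (dB.fun_mul dB) dΦ, along_mul da da,
    along_mul dB dB, along_const, along_const] at hψ
  have hD : e.D p 3 = 1 / e.Delta p 2 := by
    rw [eq_div_iff ha, mul_comm]; exact (he.normalized.components hp).1
  have hδ : e.delta p 0 = 1 / (4 * e.deltaBar p 0) := by
    rw [delta_zero, eq_div_iff (by simpa using hB)]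
    linear_combination he.four_mul hp
  rw [ip_metric, ip_metric, c0, c1, c2, c2', d0, d1, d2, e1, e2, he.deltaBar_two hp,
    (he.normalized.components hp).2.1, he.orient p hp, hδ, hD]
  set a := e.Delta p 2
  set B := e.deltaBar p 0
  set Φ := profile f (zu p)
  set xB := along X (fun q => e.deltaBar q 0) p
  set xa := along X (fun q => e.Delta q 2) p
  have key : 2 * (xa * B * Φ) + 2 * (a * xB * Φ) +
      a * B * along X (fun q => profile f (zu q)) p = 0 := by
    have h0 : (2 * a * B) * (2 * (xa * B * Φ) + 2 * (a * xB * Φ) +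
      a * B * along X (fun q => profile f (zu q)) p) = 0 := by
      linear_combination hψ
    exact (mul_eq_zero.1 h0).resolve_left (mul_ne_zero (mul_ne_zero two_ne_zero ha) hB)
  field_simp
  ring_nf
  simp only [I_sq]
  linear_combination (-2) * key

lemma alpha_eq (hp : p ∈ U) : e.alpha f p = e.deltaBar p 0 *
    dz (profile f) (zu p) / (2 * profile f (zu p)) := by
  have := he.profile_ne_zero hp
  rw [alpha, he.connection_eq hp, he.along_deltaBar he.holOn_profile hp]
  field_simp
  ring

/-- The connection component along `Δ` is `γ`, so `γ = 0` says that `φ` is constant along `Δ`. -/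
lemma profile_transport (hp : p ∈ U) :
    dz (profile f) (zu p) * (e.Delta p 0 + I * e.Delta p 1) +
      du (profile f) (zu p) * e.Delta p 2 = 0 := by
  have h0 := he.profile_ne_zero hp
  have h := he.normalized.gamma_zero p hp
  rw [gamma, he.connection_eq hp, along_zu (he.hasPD he.holOn_profile hp)] at h
  exact (div_eq_zero_iff.1 h).resolve_right (mul_ne_zero (by norm_num) h0)

lemma dz_profile_ne_zero (hα : ∀ p ∈ U, e.alpha f p ≠ 0) : ∀ q ∈ zu '' U, dz (profile f) q ≠ 0 := by
  rintro _ ⟨p, hp, rfl⟩ h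
  exact hα p hp (by rw [he.alpha_eq hp, h]; simp)

lemma holOn_tau (hα : ∀ p ∈ U, e.alpha f p ≠ 0) :
    HolOn (profileTau f) (zu '' U) ∧ HolOn (profileN f) (zu '' U) ∧ ∀ q ∈ zu '' U,
      du (profileTau f) q = dz (profileN f) q * profileTau f q -
        profileN f q * dz (profileTau f) q :=
  holOn_tau_n (isOpen_zu_image he.isOpen) he.holOn_profile (he.dz_profile_ne_zero hα)
    (fun _ _ => rfl) fun _ _ => rfl

lemma tau_ne_zero (hα : ∀ p ∈ U, e.alpha f p ≠ 0) (hp : p ∈ U) : profileTau f (zu p) ≠ 0 :=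
  div_ne_zero (he.profile_ne_zero hp) (he.dz_profile_ne_zero hα _ ⟨p, hp, rfl⟩)

lemma alpha_mul_tau (hα : ∀ p ∈ U, e.alpha f p ≠ 0) (hp : p ∈ U) :
    e.alpha f p * profileTau f (zu p) = 1 / 2 * e.deltaBar p 0 := by
  have h1 := he.profile_ne_zero hp
  have h2 := he.dz_profile_ne_zero hα _ ⟨p, hp, rfl⟩
  rw [he.alpha_eq hp, profileTau]
  field_simp

lemma deltaBar_zero_eq (hα : ∀ p ∈ U, e.alpha f p ≠ 0) (hp : p ∈ U) :
    e.deltaBar p 0 = 2 * e.alpha f p * profileTau f (zu p) := by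
  linear_combination (-2) * he.alpha_mul_tau hα hp

lemma differentiableAt_alpha (hp : p ∈ U) : DifferentiableAt ℝ (e.alpha f) p := by
  have hW := isOpen_zu_image he.isOpen
  have hol : HolOn (fun q => dz (profile f) q / (2 * profile f q)) (zu '' U) :=
    (he.holOn_profile.dz hW).div ((HolOn.const 2 _).mul he.holOn_profile hW) hW (by
      rintro _ ⟨p, hp, rfl⟩
      exact mul_ne_zero two_ne_zero (he.profile_ne_zero hp))
  refine ((he.differentiableAt_deltaBar hp 0).fun_mul
    (he.differentiableAt_zu hol hp)).congr_of_eventuallyEq ?_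
  filter_upwards [he.isOpen.mem_nhds hp] with q hq
  rw [he.alpha_eq hq, mul_div_assoc]

lemma along_alpha (hα : ∀ p ∈ U, e.alpha f p ≠ 0) (hp : p ∈ U) (X : VF) :
    along X (e.alpha f) p * profileTau f (zu p) +
      e.alpha f p * along X (fun q => profileTau f (zu q)) p =
        1 / 2 * along X (fun q => e.deltaBar q 0) p := by
  rw [← along_mul (he.differentiableAt_alpha hp) (he.differentiableAt_zu (he.holOn_tau hα).1 hp),
    along_congr (he.eventually (fun q hq => he.alpha_mul_tau hα hq) hp) X,
    along_mul (differentiableAt_const _) (he.differentiableAt_deltaBar hp 0), along_const]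
  ring

/-- Since `a` is real, `2a²B²φ = 1` makes `B²φ` real; multiplying `B²φ = B̄²φ̄` by `16B²` and using
`4BB̄ = 1` eliminates `a`. Differentiating the result gives the derivatives of `B` in terms of those
of `φ` and `φ̄`. -/
lemma conj_profile (hp : p ∈ U) :
    16 * (e.deltaBar p 0 * e.deltaBar p 0 * (e.deltaBar p 0 * e.deltaBar p 0)) *
      profile f (zu p) = conj (profile f (zu p)) := by
  have h1 := he.psi_eq hp
  have h2 := congrArg conj h1
  have h3 := he.four_mul hp
  simp only [map_mul, map_pow, Complex.conj_ofNat, he.normalized.conj_Delta hp, map_one] at h2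
  set B := e.deltaBar p 0
  set Φ := profile f (zu p)
  linear_combination (-16 * B ^ 4 * Φ) * h2 + 16 * B ^ 2 * conj B ^ 2 * conj Φ * h1 +
    conj Φ * (4 * B * conj B + 1) * h3

lemma along_deltaBar_zero (hp : p ∈ U) (X : VF) :
    64 * e.deltaBar p 0 ^ 3 * along X (fun q => e.deltaBar q 0) p * profile f (zu p) +
      16 * e.deltaBar p 0 ^ 4 * along X (fun q => profile f (zu q)) p =
        along X (fun q => conj (profile f (zu q))) p := by
  have dB := he.differentiableAt_deltaBar hp 0
  have dΦ := he.differentiableAt_zu he.holOn_profile hp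
  have dBB := dB.fun_mul dB
  rw [← along_congr (he.eventually (fun q hq => he.conj_profile hq) hp) X,
    along_mul ((differentiableAt_const _).fun_mul (dBB.fun_mul dBB)) dΦ,
    along_mul (differentiableAt_const _) (dBB.fun_mul dBB), along_mul dBB dBB, along_mul dB dB,
    along_const]
  ring

/-- `δ*` annihilates `φ̄`, so the differentiated relation gives `δ*B = -B²/(2τ)`; the rest is the
product rule in `ατ = B/2`. -/
lemma along_deltaBar_alpha (hα : ∀ p ∈ U, e.alpha f p ≠ 0) (hp : p ∈ U) :
    along e.deltaBar (e.alpha f) p =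
      (-1 - 4 * dz (profileTau f) (zu p)) * e.alpha f p ^ 2 := by
  have h1 := he.along_alpha hα hp e.deltaBar
  have h2 := he.along_deltaBar_zero hp e.deltaBar
  have hτ := he.tau_ne_zero hα hp
  have hΦ := he.profile_ne_zero hp
  have hB := he.deltaBar_ne_zero hp
  have hΦ' := he.dz_profile_ne_zero hα _ ⟨p, hp, rfl⟩
  rw [he.along_deltaBar he.holOn_profile hp, along_conj, cvf_deltaBar,
    he.along_delta he.holOn_profile hp, map_zero] at h2
  rw [he.along_deltaBar (he.holOn_tau hα).1 hp] at h1
  have h3 : along e.deltaBar (fun q => e.deltaBar q 0) p =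
      -(e.deltaBar p 0 ^ 2 / (2 * profileTau f (zu p))) := by
    have h4 : (32 * e.deltaBar p 0 ^ 3) * (2 * along e.deltaBar (fun q => e.deltaBar q 0) p *
        profile f (zu p) + e.deltaBar p 0 ^ 2 * dz (profile f) (zu p)) = 0 := by
      linear_combination h2
    have h5 := (mul_eq_zero.1 h4).resolve_left
      (mul_ne_zero (by norm_num) (pow_ne_zero 3 hB))
    rw [profileTau]
    field_simp
    linear_combination h5
  rw [h3, he.deltaBar_zero_eq hα hp] at h1
  refine mul_right_cancel₀ hτ ?_
  field_simp at h1 ⊢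
  linear_combination h1

/-- Here `δ` annihilates `φ` and `τ`, and the antiholomorphic term gives `δB = B α*`. -/
lemma along_delta_alpha (hα : ∀ p ∈ U, e.alpha f p ≠ 0) (hp : p ∈ U) :
    along e.delta (e.alpha f) p = e.alpha f p * conj (e.alpha f p) := by
  have h1 := he.along_alpha hα hp e.delta
  have h2 := he.along_deltaBar_zero hp e.delta
  have hτ := he.tau_ne_zero hα hp
  have hB := he.deltaBar_ne_zero hp
  have hΦc : conj (profile f (zu p)) ≠ 0 := by simpa using he.profile_ne_zero hp
  have hΦc' : conj (dz (profile f) (zu p)) ≠ 0 := by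
    simpa using he.dz_profile_ne_zero hα _ ⟨p, hp, rfl⟩
  rw [he.along_delta he.holOn_profile hp, along_conj, show cvf e.delta = e.deltaBar from rfl,
    he.along_deltaBar he.holOn_profile hp, map_mul, map_mul, he.deltaBar_zero_eq hα hp] at h2
  rw [he.along_delta (he.holOn_tau hα).1 hp] at h1
  have h3 := he.conj_profile hp
  simp only [map_mul, Complex.conj_ofNat, profileTau, map_div₀] at h2
  have h4 : along e.delta (fun q => e.deltaBar q 0) p =
      e.deltaBar p 0 * conj (e.alpha f p) := by
    rw [← profileTau, ← he.deltaBar_zero_eq hα hp] at h2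
    have h5 : 4 * conj (profile f (zu p)) * along e.delta (fun q => e.deltaBar q 0) p =
        4 * conj (profile f (zu p)) * (e.deltaBar p 0 * conj (e.alpha f p)) := by
      have h6 : 2 * (2 * conj (e.alpha f p) * (conj (profile f (zu p)) /
        conj (dz (profile f) (zu p)))) * conj (dz (profile f) (zu p)) =
          4 * conj (e.alpha f p) * conj (profile f (zu p)) := by field_simp; ring
      rw [h6] at h2
      linear_combination e.deltaBar p 0 * h2 -
        4 * along e.delta (fun q => e.deltaBar q 0) p * h3
    exact mul_left_cancel₀ (mul_ne_zero (by norm_num) hΦc) h5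
  rw [h4, he.deltaBar_zero_eq hα hp] at h1
  refine mul_right_cancel₀ hτ ?_
  linear_combination h1

lemma Delta_eq (hα : ∀ p ∈ U, e.alpha f p ≠ 0) (hp : p ∈ U) :
    e.Delta p 0 + I * e.Delta p 1 = e.Delta p 2 * profileN f (zu p) := by
  have h1 := he.profile_transport hp
  have h2 := he.dz_profile_ne_zero hα _ ⟨p, hp, rfl⟩
  rw [profileN]
  field_simp
  linear_combination h1

/-- `φ` and `φ̄` are constant along the real field `Δ`, hence so is `B`; and `Δτ = a(τ_u + nτ') = a
n' τ`. -/
lemma along_Delta_alpha (hα : ∀ p ∈ U, e.alpha f p ≠ 0) (hp : p ∈ U) :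
    along e.Delta (e.alpha f) p = -(e.Delta p 2 * dz (profileN f) (zu p) * e.alpha f p) := by
  have h1 := he.along_alpha hα hp e.Delta
  have h2 := he.along_deltaBar_zero hp e.Delta
  have hτ := he.tau_ne_zero hα hp
  have h0 : along e.Delta (fun q => profile f (zu q)) p = 0 := by
    rw [along_zu (he.hasPD he.holOn_profile hp), he.profile_transport hp]
  rw [h0, along_conj, along_congr_left (he.normalized.real_Delta p hp), h0, map_zero, mul_zero,
    add_zero] at h2
  have h3 : along e.Delta (fun q => e.deltaBar q 0) p = 0 := by
    have h4 := mul_ne_zero (by norm_num : (64 : ℂ) ≠ 0) (pow_ne_zero 3 (he.deltaBar_ne_zero hp))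
    exact (mul_eq_zero.1 ((mul_eq_zero.1 h2).resolve_right (he.profile_ne_zero hp))).resolve_left h4
  rw [h3, along_zu (he.hasPD (he.holOn_tau hα).1 hp), he.Delta_eq hα hp,
    (he.holOn_tau hα).2.2 _ ⟨p, hp, rfl⟩] at h1
  refine mul_right_cancel₀ hτ ?_
  linear_combination h1

lemma invA_eq (hα : ∀ p ∈ U, e.alpha f p ≠ 0) (hp : p ∈ U) :
    e.invA f p = -1 - 4 * dz (profileTau f) (zu p) := by
  rw [invA, he.along_deltaBar_alpha hα hp, mul_div_assoc, div_self (pow_ne_zero 2 (hα p hp)),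
    mul_one]

/-- The `ζ̄`-component of `Δ` is `a n̄`. Orthogonality of `δ*` and `Δ` fixes the `v`-component of
`δ*` so that the derivative of `a` cancels, leaving `4BB̄ a n̄'`. -/
lemma mu_eq (hα : ∀ p ∈ U, e.alpha f p ≠ 0) (hp : p ∈ U) :
    e.mu f p = e.Delta p 2 * conj (dz (profileN f) (zu p)) := by
  obtain ⟨c0, c1, c2⟩ := cov_metric he.isOpen he.wave hp e.delta e.Delta
  have hδ := (he.normalized.components hp).2.1
  have ha := he.Delta_ne_zero hp
  have holn := (he.holOn_tau hα).2.1
  have hconj : ∀ q ∈ U, e.Delta q 0 =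
      e.Delta q 2 * conj (profileN f (zu q)) + I * e.Delta q 1 := fun q hq => by
    have h1 := congrArg conj (he.Delta_eq hα hq)
    simp only [map_add, map_mul, conj_I, he.normalized.conj_Delta hq] at h1
    linear_combination h1
  have da := he.differentiableAt_Delta hp 2
  have d1 := he.differentiableAt_Delta hp 1
  have dn := (he.differentiableAt_zu holn hp).conj_comp
  have e0 : along e.delta (fun q => e.Delta q 0) p =
      along e.delta (fun q => e.Delta q 2) p * conj (profileN f (zu p)) +
        e.Delta p 2 * conj (2 * e.deltaBar p 0 * dz (profileN f) (zu p)) +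
        I * along e.delta (fun q => e.Delta q 1) p := by
    rw [along_congr (he.eventually hconj hp), along_add (da.fun_mul dn)
      ((differentiableAt_const _).fun_mul d1), along_mul da dn,
      along_mul (differentiableAt_const _) d1, along_const, along_conj,
      show cvf e.delta = e.deltaBar from rfl, he.along_deltaBar holn hp]
    ring
  have hb : e.deltaBar p 3 = 2 * e.deltaBar p 0 * conj (profileN f (zu p)) := by
    have h1 := congrArg conj (he.normalized.delta_Delta p hp)
    rw [ip_metric, hδ, he.orient p hp] at h1
    simp only [map_add, map_sub, map_mul, map_zero, mul_zero, zero_mul, sub_zero, conj_I,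
      Complex.conj_ofNat, he.normalized.conj_Delta hp, ← deltaBar_apply] at h1
    rw [hconj p hp] at h1
    refine mul_right_cancel₀ ha ?_
    linear_combination -h1
  rw [mu, ip_metric, c0, c1, c2, hδ, he.deltaBar_two hp, he.deltaBar_one hp, e0, hb]
  simp only [map_mul, Complex.conj_ofNat]
  have h4 := he.four_mul hp
  linear_combination (e.Delta p 2 * conj (dz (profileN f) (zu p))) * h4

/-- The consequences of type `(0,1)` for an oriented tetrad. -/
theorem of_isType01 (h01 : IsType01 f e U) (hp : p ∈ U) :
    e.invA f p * conj (e.invA f p) = 1 ∧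
      dz (profileN f) (zu p) = e.invA f p * conj (dz (profileN f) (zu p)) := by
  obtain ⟨hα, hw⟩ := h01
  have hα0 := hα p hp
  have hαc : conj (e.alpha f p) ≠ 0 := by simpa using hα0
  have d1 : along e.deltaBar (e.alpha f) p = e.invA f p * e.alpha f p ^ 2 := by
    rw [he.along_deltaBar_alpha hα hp, he.invA_eq hα hp]
  have d2 := he.along_delta_alpha hα hp
  have d3 := he.along_Delta_alpha hα hp
  have s1 : along e.deltaBar (e.alphaStar f) p = e.alpha f p * conj (e.alpha f p) := by
    change along e.deltaBar (fun q => conj (e.alpha f q)) p = _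
    rw [along_conj, cvf_deltaBar, d2, map_mul, conj_conj, mul_comm]
  have s2 : along e.delta (e.alphaStar f) p = conj (e.invA f p) * conj (e.alpha f p) ^ 2 := by
    change along e.delta (fun q => conj (e.alpha f q)) p = _
    rw [along_conj, show cvf e.delta = e.deltaBar from rfl, d1, map_mul, map_pow]
  have s3 : along e.Delta (e.alphaStar f) p =
      -(e.Delta p 2 * conj (dz (profileN f) (zu p)) * conj (e.alpha f p)) := by
    change along e.Delta (fun q => conj (e.alpha f q)) p = _
    rw [along_conj, along_congr_left (he.normalized.real_Delta p hp), d3, map_neg, map_mul, map_mul,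
      he.normalized.conj_Delta hp]
  -- The pair `(δ*, δ)` gives `AA* = 1`, and `(δ*, Δ)` gives `n' = A n̄'`.
  have w1 := along_eq_of_wedge hw hp e.deltaBar e.delta
  have w2 := along_eq_of_wedge hw hp e.deltaBar e.Delta
  rw [d1, s2, d2, s1] at w1
  rw [d1, s3, d3, s1] at w2
  constructor
  · refine mul_left_cancel₀ (mul_ne_zero (pow_ne_zero 2 hα0) (pow_ne_zero 2 hαc)) ?_
    linear_combination w1
  · refine mul_left_cancel₀ (mul_ne_zero (mul_ne_zero (pow_ne_zero 2 hα0) hαc)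
      (he.Delta_ne_zero hp)) ?_
    linear_combination w2

lemma invB_eq_zero (h01 : IsType01 f e U) (hp : p ∈ U) : e.invB f p = 0 := by
  have h := (he.of_isType01 h01 hp).2
  rw [invB, he.mu_eq h01.1 hp, map_mul, conj_conj, he.normalized.conj_Delta hp]
  linear_combination (-e.Delta p 2) * h

end IsOriented

end Tetrad

/-! ### Reversal of the orientation -/

lemma ip_cvf (G : Pt → Matrix (Fin 4) (Fin 4) ℝ) (X Y : VF) (p : Pt) :
    ip G (cvf X) (cvf Y) p = conj (ip G X Y p) := by
  simp [ip, cvf]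

lemma cov_cvf (G : Pt → Matrix (Fin 4) (Fin 4) ℝ) (X Y : VF) :
    cov G (cvf X) (cvf Y) = cvf (cov G X Y) := by
  funext p k
  simp [cov, cvf, pd_conj]

lemma ip_congr {G : Pt → Matrix (Fin 4) (Fin 4) ℝ} {X X' Y Y' : VF} {p : Pt} (hX : X p = X' p)
    (hY : Y p = Y' p) : ip G X Y p = ip G X' Y' p := by
  simp only [ip, hX, hY]

lemma cov_congr {G : Pt → Matrix (Fin 4) (Fin 4) ℝ} {X X' Y Y' : VF} {p : Pt} (hX : X p = X' p)
    (hY : Y =ᶠ[𝓝 p] Y') : cov G X Y p = cov G X' Y' p := by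
  funext k
  have : ∀ i, pd i (fun q => Y q k) p = pd i (fun q => Y' q k) p := fun i =>
    pd_congr (hY.mono fun q hq => by rw [hq]) i
  simp only [cov, hX, this, hY.eq_of_nhds]

namespace Tetrad

/-- The tetrad `(δ*, δ, Δ, D)`. -/
def swap (e : Tetrad) : Tetrad := ⟨e.deltaBar, e.Delta, e.D⟩

variable {f : ℂ → ℝ → ℂ} {U : Set Pt} {e : Tetrad} {p : Pt}

lemma swap_deltaBar (e : Tetrad) : e.swap.deltaBar = e.delta := cvf_deltaBar e

namespace IsNormalized

variable (he : e.IsNormalized f U) (hU : IsOpen U) (hp : p ∈ U)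
include he hU hp

lemma cvf_Delta_eventually : cvf e.Delta =ᶠ[𝓝 p] e.Delta := by
  filter_upwards [hU.mem_nhds hp] with q hq using he.real_Delta q hq

/-- The metric and its connection are real, so conjugating all the vectors conjugates the
coefficient; `Δ` and `D` are unchanged. The other swap lemmas rest on the same fact. -/
lemma alpha_swap : e.swap.alpha f p = conj (e.alpha f p) := by
  have h1 : cov (metric f) e.delta e.Delta p = cvf (cov (metric f) e.deltaBar e.Delta) p := by
    rw [← cov_cvf, cvf_deltaBar]
    exact cov_congr rfl (he.cvf_Delta_eventually hU hp).symm
  have h2 : cov (metric f) e.delta e.delta = cvf (cov (metric f) e.deltaBar e.deltaBar) := by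
    rw [← cov_cvf, cvf_deltaBar]
  simp only [alpha, swap_deltaBar]
  rw [show e.swap.delta = cvf e.delta from rfl, show e.swap.Delta = e.Delta from rfl,
    show e.swap.D = e.D from rfl, map_mul, map_sub, ← ip_cvf, ← ip_cvf, ← h2,
    ip_congr (X := cvf e.D) (he.real_D p hp) h1.symm]
  simp [Complex.conj_ofNat]

lemma gamma_swap : e.swap.gamma f p = conj (e.gamma f p) := by
  have h1 : cov (metric f) e.Delta e.Delta p = cvf (cov (metric f) e.Delta e.Delta) p := by
    rw [← cov_cvf]
    exact cov_congr (he.real_Delta p hp).symm (he.cvf_Delta_eventually hU hp).symm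
  have h2 : cov (metric f) e.Delta e.delta p = cvf (cov (metric f) e.Delta e.deltaBar) p := by
    rw [← cov_cvf, cvf_deltaBar]
    exact cov_congr (he.real_Delta p hp).symm EventuallyEq.rfl
  simp only [gamma, swap_deltaBar]
  rw [show e.swap.delta = cvf e.delta from rfl, show e.swap.Delta = e.Delta from rfl,
    show e.swap.D = e.D from rfl, map_mul, map_sub, ← ip_cvf, ← ip_cvf,
    ip_congr (X := cvf e.D) (he.real_D p hp) h1.symm,
    ip_congr (X := cvf e.delta) rfl h2.symm]
  simp [Complex.conj_ofNat]

lemma mu_swap : e.swap.mu f p = conj (e.mu f p) := by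
  have h1 : cov (metric f) e.deltaBar e.Delta p = cvf (cov (metric f) e.delta e.Delta) p := by
    rw [← cov_cvf]
    exact cov_congr rfl (he.cvf_Delta_eventually hU hp).symm
  simp only [mu, swap_deltaBar]
  rw [show e.swap.delta = e.deltaBar from rfl, show e.swap.Delta = e.Delta from rfl,
    ← ip_cvf, cvf_deltaBar]
  exact ip_congr rfl h1

lemma invA_swap : e.swap.invA f p = conj (e.invA f p) := by
  have h1 : e.swap.alpha f =ᶠ[𝓝 p] fun q => conj (e.alpha f q) := by
    filter_upwards [hU.mem_nhds hp] with q hq using he.alpha_swap hU hq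
  simp only [invA, swap_deltaBar]
  rw [along_congr h1, along_conj, he.alpha_swap hU hp, map_div₀, map_pow]
  rfl

lemma invB_swap : e.swap.invB f p = conj (e.invB f p) := by
  simp only [invB]
  rw [he.mu_swap hU hp, he.invA_swap hU hp]
  simp

omit hp

lemma swap : e.swap.IsNormalized f U where
  smooth_delta := by
    rw [contDiffOn_pi]
    exact fun i => conjCLE.contDiff.comp_contDiffOn (contDiffOn_pi.1 he.smooth_delta i)
  smooth_Delta := he.smooth_Delta
  smooth_D := he.smooth_D
  real_Delta := he.real_Delta
  real_D := he.real_D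
  delta_delta p hp := by
    change ip (metric f) (cvf e.delta) (cvf e.delta) p = 0
    rw [ip_cvf, he.delta_delta p hp, map_zero]
  delta_deltaBar p hp := by
    change ip (metric f) (cvf e.delta) (cvf e.deltaBar) p = 1
    rw [ip_cvf, he.delta_deltaBar p hp, map_one]
  delta_Delta p hp := by
    change ip (metric f) (cvf e.delta) e.Delta p = 0
    rw [ip_congr rfl (he.real_Delta p hp).symm, ip_cvf, he.delta_Delta p hp, map_zero]
  delta_D p hp := by
    change ip (metric f) (cvf e.delta) e.D p = 0
    rw [ip_congr rfl (he.real_D p hp).symm, ip_cvf, he.delta_D p hp, map_zero]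
  Delta_Delta := he.Delta_Delta
  D_D := he.D_D
  Delta_D := he.Delta_D
  aligned := he.aligned
  psi4 p hp := by
    have h := congrArg conj (he.psi4 p hp)
    have hΔ := he.conj_Delta hp
    rw [map_one] at h
    rw [← h]
    change curv (metric f) e.Delta e.swap.deltaBar e.Delta e.swap.deltaBar p = _
    rw [swap_deltaBar]
    simp [Psi4, curv, deltaBar_apply, hΔ]
  gamma_zero p hp := by rw [he.gamma_swap hU hp, he.gamma_zero p hp, map_zero]

lemma isType01_swap (h : IsType01 f e U) : IsType01 f e.swap U := by
  refine ⟨fun p hp => ?_, fun p hp i j => ?_⟩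
  · rw [he.alpha_swap hU hp]; simpa using h.1 p hp
  · have h1 : e.swap.alpha f =ᶠ[𝓝 p] fun q => conj (e.alpha f q) := by
      filter_upwards [hU.mem_nhds hp] with q hq using he.alpha_swap hU hq
    have h2 : e.swap.alphaStar f =ᶠ[𝓝 p] fun q => conj (e.alphaStar f q) := by
      filter_upwards [hU.mem_nhds hp] with q hq
      simp [alphaStar, he.alpha_swap hU hq]
    have h3 := congrArg conj (h.2 p hp i j)
    simp only [pd_congr h1, pd_congr h2, pd_conj]
    simpa using h3

/-- On a connected region either the tetrad or its swap is oriented. -/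
lemma isOriented_or_swap (hUc : IsPreconnected U) (hf : IsVacuumPPWave f U) :
    e.IsOriented f U ∨ e.swap.IsOriented f U := by
  have hc : ∀ i, ContinuousOn (fun p => e.delta p i) U := fun i =>
    (contDiffOn_pi.1 he.smooth_delta i).continuousOn
  have h0 : ∀ {p}, p ∈ U → I * e.delta p 0 ≠ 0 := fun {p} hp h => by
    have h1 := (he.components hp).2.2
    have h2 : e.delta p 0 = 0 := (mul_eq_zero.1 h).resolve_left I_ne_zero
    rw [h2, mul_zero, zero_pow two_ne_zero] at h1
    have h3 : e.delta p 1 = 0 := pow_eq_zero_iff two_ne_zero |>.1 h1.1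
    simpa [h2, h3] using h1.2
  -- Pointwise `δ¹ = ± i δ⁰`, with `δ⁰` nowhere zero; on a connected set the sign cannot change.
  rcases hUc.eq_or_eq_neg_of_sq_eq (hc 1) (continuousOn_const.mul (hc 0))
    (fun p hp => (he.components hp).2.2.1) h0 with h | h
  · exact Or.inl ⟨hU, hf, he, fun p hp => h hp⟩
  · refine Or.inr ⟨hU, hf, he.swap hU, fun p hp => ?_⟩
    have h1 := h hp
    simp only [Pi.neg_apply] at h1
    change conj (e.delta p 1) = I * conj (e.delta p 0)
    rw [h1]; simp

end IsNormalized

theorem IsOriented.classification (he : e.IsOriented f U) (hUc : IsConnected U)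
    (h01 : IsType01 f e U) :
    (∀ p ∈ U, e.invB f p = 0) ∧
    ((∃ k₀ k₁ : ℝ, 0 < k₀ ∧ k₁ ≠ 0 ∧
        (∀ p ∈ U, e.invA f p * conj (e.invA f p) = 1 ∧ e.invA f p ^ 2 ≠ 1) ∧
        ∀ p ∈ U, HasFormNear (FormP k₀ k₁) f U (zu p)) ∨
     (∃ k : ℝ, 0 < k ∧ (∀ p ∈ U, e.invA f p = -1) ∧
        ∀ p ∈ U, HasFormNear (FormE k) f U (zu p)) ∨
     (∃ k : ℝ, (∀ p ∈ U, e.invA f p = 1) ∧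
        ∀ p ∈ U, HasFormNear (FormL k) f U (zu p))) := by
  refine ⟨fun p hp => he.invB_eq_zero h01 hp, ?_⟩
  obtain ⟨A, hA, hd⟩ := exists_profileData (isOpen_zu_image he.isOpen)
    (hUc.image zu continuous_zu.continuousOn) (he.wave.holOn he.isOpen)
    (by rintro _ ⟨p, hp, rfl⟩; exact he.profile_ne_zero hp) (he.dz_profile_ne_zero h01.1)
    (A := fun q => -1 - 4 * dz (profileTau f) q) (τ := profileTau f) (n := profileN f)
    (fun _ _ => rfl) (fun _ _ => rfl) (fun _ _ => rfl)
    (by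
      rintro _ ⟨p, hp, rfl⟩
      rw [← he.invA_eq h01.1 hp]; exact (he.of_isType01 h01 hp).1)
    (by
      rintro _ ⟨p, hp, rfl⟩
      rw [← he.invA_eq h01.1 hp]; exact (he.of_isType01 h01 hp).2)
  have hA' : ∀ p ∈ U, e.invA f p = A := fun p hp => by
    rw [he.invA_eq h01.1 hp]; exact hA _ ⟨p, hp, rfl⟩
  by_cases h1 : A = 1
  · obtain ⟨k, hk⟩ := hd.hasFormNear_formL h1 hUc.nonempty
    exact Or.inr (Or.inr ⟨k, fun p hp => (hA' p hp).trans h1, hk⟩)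
  by_cases h2 : A = -1
  · obtain ⟨k, hk0, hk⟩ := hd.hasFormNear_formE h2 hUc.nonempty
    exact Or.inr (Or.inl ⟨k, hk0, fun p hp => (hA' p hp).trans h2, hk⟩)
  · obtain ⟨k₀, k₁, h3, h4, hk⟩ := hd.hasFormNear_formP h1 h2 hUc.nonempty
    refine Or.inl ⟨k₀, k₁, h3, h4, fun p hp => ⟨(he.of_isType01 h01 hp).1, ?_⟩, hk⟩
    rw [hA' p hp, Ne, sq_eq_one_iff]
    tauto

end Tetrad

end PPWave

end

theorem proposition4p4 (U : Set PPWave.Pt) (hU : IsOpen U) (hUc : IsConnected U)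
    (f : ℂ → ℝ → ℂ) (hf : PPWave.IsVacuumPPWave f U)
    (e : PPWave.Tetrad) (he : e.IsNormalized f U) (h01 : PPWave.IsType01 f e U) :
    (∀ p ∈ U, e.invB f p = 0) ∧
    ((∃ k₀ k₁ : ℝ, 0 < k₀ ∧ k₁ ≠ 0 ∧
        (∀ p ∈ U, e.invA f p * (starRingEnd ℂ) (e.invA f p) = 1 ∧ e.invA f p ^ 2 ≠ 1) ∧
        ∀ p ∈ U, PPWave.HasFormNear (PPWave.FormP k₀ k₁) f U (PPWave.zu p)) ∨
     (∃ k : ℝ, 0 < k ∧ (∀ p ∈ U, e.invA f p = -1) ∧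
        ∀ p ∈ U, PPWave.HasFormNear (PPWave.FormE k) f U (PPWave.zu p)) ∨
     (∃ k : ℝ, (∀ p ∈ U, e.invA f p = 1) ∧
        ∀ p ∈ U, PPWave.HasFormNear (PPWave.FormL k) f U (PPWave.zu p))) := by
  rcases he.isOriented_or_swap hU hUc.isPreconnected hf with ho | ho
  · exact ho.classification hUc h01
  -- The normal forms of `f` do not involve the tetrad, and the conditions on `A` and `B` are
  -- invariant under conjugation, so the result for the swapped tetrad transfers.
  · have hA : ∀ p ∈ U, e.invA f p = (starRingEnd ℂ) (e.swap.invA f p) := fun p hp => by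
      rw [he.invA_swap hU hp, Complex.conj_conj]
    obtain ⟨hB, h⟩ := ho.classification hUc (he.isType01_swap hU h01)
    refine ⟨fun p hp => ?_, ?_⟩
    · have := hB p hp
      rw [he.invB_swap hU hp] at this
      simpa using this
    · rcases h with ⟨k₀, k₁, h0, h1, h2, h3⟩ | ⟨k, h0, h2, h3⟩ | ⟨k, h2, h3⟩
      · refine Or.inl ⟨k₀, k₁, h0, h1, fun p hp => ?_, h3⟩
        obtain ⟨h4, h5⟩ := h2 p hp
        rw [hA p hp, Complex.conj_conj, mul_comm]
        refine ⟨h4, fun h6 => h5 ?_⟩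
        have := congrArg (starRingEnd ℂ) h6
        simpa using this
      · exact Or.inr (Or.inl ⟨k, h0, fun p hp => by rw [hA p hp, h2 p hp]; simp, h3⟩)
      · exact Or.inr (Or.inr ⟨k, fun p hp => by rw [hA p hp, h2 p hp]; simp, h3⟩)
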